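/- Let $x^1,x^2,x^3$ be the coordinates on $\mathbb R^3$, with partial derivatives $\partial_1,\partial_2,\partial_3$. Let $H=\{x\in\mathbb R^3\mid x^1=0\}$. Cyclic $(i,j,k)$ means $(i,j,k)\in\{(1,2,3),(2,3,1),(3,1,2)\}$. Let $\mathcal G$ be the set of all real analytic germs at $0\in\mathbb R^3$ of functions $D_i^j$, $c_{ij}^k$, $g_i^0$, $\xi$ (with $i,j,k\in\{1,2,3\}$) such that, with the vector fields $D_i=\sum_j D_i^j\partial_j$: - $D_1,D_2,D_3$ is a frame near $0$, that is, $D_1(0),D_2(0),D_3(0)$ are linearly independent; furthermore $D_1=\partial_1$, $D_2^1(0)>0$ and $D_3^1(0)>0$; - $[D_j,D_k]=\sum_{i=1}^3 c_{jk}^i D_i$ for all $j,k$; - $0=g_2^0g_3^0+g_3^0g_1^0+g_1^0g_2^0$; - $0=D_i(g_j^0+g_k^0)+c_{ij}^j(g_i^0-g_j^0)+c_{ik}^k(g_i^0-g_k^0)-2D_i(\xi)\,g_i^0$ for all cyclic $(i,j,k)$; - $(g_1^0,g_2^0,g_3^0)=\tfrac12 e^{a}\,(1,-1-u,-1-\tfrac1u)$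 for some germs $a$ and $u$ at $0\in\mathbb R^3$ of real analytic functions with $u(0)>0$ (these $a,u$ are uniquely determined by the $g_i^0$). Let $\mathcal D$ be the set of all tuples consisting of six real analytic germs $c_{31}^i$, $c_{12}^i$ ($i=1,2,3$) at $0\in\mathbb R^3$ and nine real analytic germs $D_2^i$, $D_3^i$ ($i=1,2,3$), $a$, $u$, $\xi$ at $0\in H$, subject to $D_2^1(0)>0$, $D_3^1(0)>0$, $u(0)>0$ and to the linear independence of the three vectors $(1,0,0)$, $(D_2^1(0),D_2^2(0),D_2^3(0))$, $(D_3^1(0),D_3^2(0),D_3^3(0))$ in $\mathbb R^3$. Then the map $\mathcal G\to\mathcal D$ that is given by the identity on $c_{31}^i$, $c_{12}^i$ and by restriction to $H$ for $D_2^i$, $D_3^i$, $a$, $u$, $\xi$ is bijective. -/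

import Mathlib

open Filter Topology

noncomputable section

/-- The ring of real analytic germs at `0` of real-valued functions on `E`: germs at `0` that have a
representative which is real analytic at `0`. -/
def analyticGermRing (E : Type*) [NormedAddCommGroup E] [NormedSpace ℝ E] :
    Subring (Germ (𝓝 (0 : E)) ℝ) where
  carrier := {φ | ∃ f : E → ℝ, AnalyticAt ℝ f 0 ∧ (f : Germ (𝓝 (0 : E)) ℝ) = φ}
  mul_mem' := by
    rintro _ _ ⟨f, hf, rfl⟩ ⟨g, hg, rfl⟩
    exact ⟨f * g, hf.mul hg, rfl⟩
  one_mem' := ⟨1, analyticAt_const, rfl⟩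
  add_mem' := by
    rintro _ _ ⟨f, hf, rfl⟩ ⟨g, hg, rfl⟩
    exact ⟨f + g, hf.add hg, rfl⟩
  zero_mem' := ⟨0, analyticAt_const, rfl⟩
  neg_mem' := by
    rintro _ ⟨f, hf, rfl⟩
    exact ⟨-f, hf.neg, rfl⟩

/-- Real analytic germs at `0` of real-valued functions on `E`. -/
abbrev AnalyticGerm (E : Type*) [NormedAddCommGroup E] [NormedSpace ℝ E] : Type _ :=
  analyticGermRing E

/-- The value of an analytic germ at the base point `0`. -/
def AnalyticGerm.val0 {E : Type*} [NormedAddCommGroup E] [NormedSpace ℝ E]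
    (φ : AnalyticGerm E) : ℝ :=
  Germ.value (φ : Germ (𝓝 (0 : E)) ℝ)

/-- Coordinate space `ℝ³`. The coordinates `x¹, x², x³` are `x 0, x 1, x 2`. -/
abbrev R3 : Type := Fin 3 → ℝ

/-- The hypersurface `x¹ = 0` in `ℝ³`. -/
def hyp : Submodule ℝ R3 := LinearMap.ker (LinearMap.proj (R := ℝ) (φ := fun _ : Fin 3 => ℝ) 0)

/-- The partial derivative `∂_j` on germs at `0` of functions on `ℝ³`. -/
def germPartial (j : Fin 3) (φ : Germ (𝓝 (0 : R3)) ℝ) : Germ (𝓝 (0 : R3)) ℝ :=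
  φ.liftOn (fun f => ((fun x => fderiv ℝ f x (Pi.single j 1) : R3 → ℝ) : Germ (𝓝 (0 : R3)) ℝ))
    (by
      intro f g h
      refine Germ.coe_eq.mpr ?_
      filter_upwards [EventuallyEq.fderiv (𝕜 := ℝ) h] with x hx
      rw [hx])

/-- The partial derivative `∂_j` of an analytic germ on `ℝ³`. -/
def AnalyticGerm.partialD (j : Fin 3) (φ : AnalyticGerm R3) : AnalyticGerm R3 :=
  ⟨germPartial j φ, by
    obtain ⟨_, f, hf, rfl⟩ := φ
    exact ⟨fun x => fderiv ℝ f x (Pi.single j 1),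
      ((ContinuousLinearMap.apply ℝ ℝ (Pi.single j 1 : R3)).analyticAt _).comp hf.fderiv, rfl⟩⟩

/-- Restriction of an analytic germ on `ℝ³` to the hypersurface `x¹ = 0`. -/
def AnalyticGerm.restrict (φ : AnalyticGerm R3) : AnalyticGerm hyp :=
  ⟨(φ : Germ (𝓝 (0 : R3)) ℝ).compTendsto (fun y : hyp => (y : R3))
      (continuous_subtype_val.tendsto (0 : hyp)), by
    obtain ⟨_, f, hf, rfl⟩ := φ
    refine ⟨fun y : hyp => f y, ?_, rfl⟩
    have h0 : AnalyticAt ℝ f (hyp.subtypeL 0) := by simpa using hf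
    exact h0.comp (hyp.subtypeL.analyticAt 0)⟩

theorem AnalyticGerm.val0_restrict (φ : AnalyticGerm R3) : φ.restrict.val0 = φ.val0 := by
  obtain ⟨_, f, hf, rfl⟩ := φ
  rfl

/-- A germ of an analytic vector field `X = X¹ ∂₁ + X² ∂₂ + X³ ∂₃`, given by its components. -/
abbrev VF : Type := Fin 3 → AnalyticGerm R3

/-- The derivative `X(f) = ∑ j, X^j ∂_j f`. -/
def VF.app (X : VF) (f : AnalyticGerm R3) : AnalyticGerm R3 :=
  ∑ j, X j * f.partialD j

/-- The commutator `[X, Y]`, with components `X(Y^q) - Y(X^q)`. -/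
def VF.bracket (X Y : VF) : VF := fun q => VF.app X (Y q) - VF.app Y (X q)

/-- The set of all real analytic germs at `0 ∈ ℝ³` of solutions. Here `D i j` is `D_i^j`,
`c i j k` is `c_{ij}^k`, `g i` is `g_i^0`, and the indices `1, 2, 3` are written `0, 1, 2`.
The triples `(i, i + 1, i + 2)` in `Fin 3` are the cyclic ones. -/
@[ext]
structure SolutionGerm where
  D : Fin 3 → VF
  c : Fin 3 → Fin 3 → Fin 3 → AnalyticGerm R3
  g : Fin 3 → AnalyticGerm R3
  ξ : AnalyticGerm R3
  a : AnalyticGerm R3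
  u : AnalyticGerm R3
  /-- `D₁, D₂, D₃` is a frame near `0`. -/
  frame : LinearIndependent ℝ (fun i j => (D i j).val0)
  /-- `[D_j, D_k] = ∑ i, c_{jk}^i D_i`. -/
  structure_eq : ∀ j k, VF.bracket (D j) (D k) = ∑ i, fun q => c j k i * D i q
  /-- `0 = g_2^0 g_3^0 + g_3^0 g_1^0 + g_1^0 g_2^0`. -/
  quadratic : 0 = g 1 * g 2 + g 2 * g 0 + g 0 * g 1
  /-- `0 = D_i(g_j^0 + g_k^0) + c_{ij}^j (g_i^0 - g_j^0) + c_{ik}^k (g_i^0 - g_k^0)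
    - 2 D_i(ξ) g_i^0` for cyclic `(i, j, k)`. -/
  constraint : ∀ i j k : Fin 3, j = i + 1 → k = i + 2 →
    0 = VF.app (D i) (g j + g k) + c i j j * (g i - g j) + c i k k * (g i - g k)
      - 2 * VF.app (D i) ξ * g i
  /-- `D₁ = ∂₁`. -/
  D_one : D 0 = Pi.single 0 1
  D_two_pos : 0 < (D 1 0).val0
  D_three_pos : 0 < (D 2 0).val0
  u_pos : 0 < u.val0
  /-- `(g_1^0, g_2^0, g_3^0) = ½ e^a (1, -1 - u, -1 - 1/u)`. -/
  g_eq : ∀ i, (g i : Germ (𝓝 (0 : R3)) ℝ) =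
    Germ.map₂ (fun a u : ℝ => 1 / 2 * Real.exp a * ![1, -1 - u, -1 - 1 / u] i) a u

/-- The free data: six analytic germs on `ℝ³`, nine analytic germs on `x¹ = 0`. -/
@[ext]
structure FreeData where
  c31 : Fin 3 → AnalyticGerm R3
  c12 : Fin 3 → AnalyticGerm R3
  D2 : Fin 3 → AnalyticGerm hyp
  D3 : Fin 3 → AnalyticGerm hyp
  a : AnalyticGerm hyp
  u : AnalyticGerm hyp
  ξ : AnalyticGerm hyp
  D2_pos : 0 < (D2 0).val0
  D3_pos : 0 < (D3 0).val0
  u_pos : 0 < u.val0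
  /-- `∂₁, D₂, D₃` are linearly independent at `0`. -/
  frame : LinearIndependent ℝ
    ![(Pi.single 0 1 : R3), fun j => (D2 j).val0, fun j => (D3 j).val0]

/-- Identity on `c_{31}^i`, `c_{12}^i`, and restriction to `x¹ = 0` of
`D_2^i`, `D_3^i`, `a`, `u`, `ξ`. -/
def SolutionGerm.toFreeData (s : SolutionGerm) : FreeData where
  c31 := s.c 2 0
  c12 := s.c 0 1
  D2 := fun j => (s.D 1 j).restrict
  D3 := fun j => (s.D 2 j).restrict
  a := s.a.restrict
  u := s.u.restrict
  ξ := s.ξ.restrict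
  D2_pos := by simpa only [AnalyticGerm.val0_restrict] using s.D_two_pos
  D3_pos := by simpa only [AnalyticGerm.val0_restrict] using s.D_three_pos
  u_pos := by simpa only [AnalyticGerm.val0_restrict] using s.u_pos
  frame := by
    have h := s.frame
    convert h using 1
    funext i
    fin_cases i
    · funext j
      have hD : s.D 0 = Pi.single 0 1 := s.D_one
      fin_cases j <;> simp [hD] <;> rfl
    · funext j
      exact AnalyticGerm.val0_restrict _
    · funext j
      exact AnalyticGerm.val0_restrict _

/-- The germs `a` and `u` are determined by the `g_i^0`, so that a solution germ is the same thing
as a tuple `(D, c, g, ξ)` for which suitable `a` and `u` exist. -/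
theorem SolutionGerm.ext_of_tuple {s t : SolutionGerm} (hD : s.D = t.D) (hc : s.c = t.c)
    (hg : s.g = t.g) (hξ : s.ξ = t.ξ) : s = t := by
  have h0 := (s.g_eq 0).symm.trans ((congrArg (fun g => ((g 0 : AnalyticGerm R3) :
    Germ (𝓝 (0 : R3)) ℝ)) hg).trans (t.g_eq 0))
  have h1 := (s.g_eq 1).symm.trans ((congrArg (fun g => ((g 1 : AnalyticGerm R3) :
    Germ (𝓝 (0 : R3)) ℝ)) hg).trans (t.g_eq 1))
  have key : ∀ a u a' u' : Germ (𝓝 (0 : R3)) ℝ,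
      Germ.map₂ (fun a u : ℝ => 1 / 2 * Real.exp a * ![1, -1 - u, -1 - 1 / u] 0) a u =
        Germ.map₂ (fun a u : ℝ => 1 / 2 * Real.exp a * ![1, -1 - u, -1 - 1 / u] 0) a' u' →
      Germ.map₂ (fun a u : ℝ => 1 / 2 * Real.exp a * ![1, -1 - u, -1 - 1 / u] 1) a u =
        Germ.map₂ (fun a u : ℝ => 1 / 2 * Real.exp a * ![1, -1 - u, -1 - 1 / u] 1) a' u' →
      a = a' ∧ u = u' := by
    intro a u a' u'
    refine Germ.inductionOn₂ a u fun a u => ?_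
    refine Germ.inductionOn₂ a' u' fun a' u' => ?_
    intro h0 h1
    have h0' := Germ.coe_eq.mp h0
    have h1' := Germ.coe_eq.mp h1
    constructor
    · refine Germ.coe_eq.mpr ?_
      filter_upwards [h0'] with x hx
      simpa using hx
    · refine Germ.coe_eq.mpr ?_
      filter_upwards [h0', h1'] with x hx hx'
      have : a x = a' x := by simpa using hx
      simpa [this] using hx'
  obtain ⟨ha, hu⟩ := key _ _ _ _ h0 h1
  exact SolutionGerm.ext hD hc hg hξ (Subtype.ext ha) (Subtype.ext hu)

end

/-! The equations are solved in triangular order, and each stage is an analytic Cauchy problem with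
data on `x¹ = 0`.

Frame. Since `D₁ = ∂₁`, the brackets `[D₁, D₂]` and `[D₃, D₁]` are componentwise `x¹`-derivatives,
so prescribing `c_{12}` and `c_{31}` gives linear ordinary differential equations in `x¹`, with
parameters, for `D₂` and `D₃` (`exists_frame`, `frame_eq`). The frame matrix is invertible over the
ring of germs, so the remaining structure coefficients are determined, and they exist.

Scalars. Inserting the parametrization of `g` makes the quadratic equation automatic and turns the
three constraints into a first order quasilinear system for `a`, `u`, `ξ`
(`constraint_iff_reducedSystem`). The components `D_2^1` and `D_3^1` are units. After division by
them, the matrix of coefficients of the `∂₁`-derivatives has determinant `symbolDet u`, which is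
positive at `0` because `u(0) > 0`. Hence `H` is noncharacteristic, and the system can be solved for
the `∂₁`-derivatives by Cramer's rule.

Existence in the Cauchy problem (`exists_isConvergent_eq_add_primitive`) comes from Picard iteration
for `u = u₀ + ∫ F(u) dx¹` on formal power series. Two weighted `ℓ¹` norms are used: `weight` gives
an algebra norm, and `weightD` gives a module norm over it. Tangential derivatives are bounded from
the first to the second, and integration in `x¹` is bounded from the second to the first with
constant `ρ`. A small `ρ` keeps all iterates in one ball. The iterates stabilize coefficient by
coefficient, because each integration gains a power of `x¹`, and the limit inherits the bound.

Uniqueness (`AnalyticGerm.eq_zero_of_partialD_mem_span`) is formal: the difference of two solutions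
is divisible by every power of `x¹`. The passage between germs and series is the isomorphism
`sumGerm` of convergent power series with analytic germs. -/

open Filter Topology

noncomputable section

open MvPowerSeries Finset

/-! ### Weighted `ℓ¹` norms on formal power series -/

/-- Formal power series in three variables. -/
abbrev FormalSeries : Type := MvPowerSeries (Fin 3) ℝ

/-- The weighted `ℓ¹` norm `∑ w(α) |p_α|` of a formal power series, with values in `[0, ∞]`. -/
def wnorm (w : (Fin 3 →₀ ℕ) → ENNReal) (p : FormalSeries) : ENNReal :=
  ∑' α, w α * ‖coeff α p‖ₑ

section wnorm

variable {w w₁ w₂ : (Fin 3 →₀ ℕ) → ENNReal}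

@[simp]
theorem wnorm_zero : wnorm w 0 = 0 := by simp [wnorm]

theorem wnorm_neg (p : FormalSeries) : wnorm w (-p) = wnorm w p := by simp [wnorm]

theorem wnorm_add_le (p q : FormalSeries) : wnorm w (p + q) ≤ wnorm w p + wnorm w q := by
  rw [wnorm, wnorm, wnorm, ← ENNReal.tsum_add]
  refine ENNReal.tsum_le_tsum fun α => ?_
  rw [← mul_add, map_add]
  gcongr
  exact enorm_add_le _ _

theorem wnorm_mono {c : ENNReal} (h : ∀ α, w₁ α ≤ c * w₂ α) (p : FormalSeries) :
    wnorm w₁ p ≤ c * wnorm w₂ p := by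
  rw [wnorm, wnorm, ← ENNReal.tsum_mul_left]
  refine ENNReal.tsum_le_tsum fun α => ?_
  rw [← mul_assoc]
  gcongr
  exact h α

/-- The Cauchy product; in `[0, ∞]` no summability has to be assumed, so the norm estimates hold for
divergent series as well. -/
theorem ENNReal.tsum_mul_tsum_antidiagonal (f g : (Fin 3 →₀ ℕ) → ENNReal) :
    ∑' α, ∑ x ∈ antidiagonal α, f x.1 * g x.2 = (∑' α, f α) * ∑' α, g α := by
  have h : (∑' α, f α) * ∑' α, g α = ∑' x : (Fin 3 →₀ ℕ) × (Fin 3 →₀ ℕ), f x.1 * g x.2 := by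
    rw [ENNReal.tsum_prod', ← ENNReal.tsum_mul_right]
    simp_rw [ENNReal.tsum_mul_left]
  rw [h, ← Finset.HasAntidiagonal.sigmaAntidiagonalEquivProd.tsum_eq, ENNReal.tsum_sigma']
  refine tsum_congr fun α => ?_
  rw [tsum_fintype, ← Finset.sum_finset_coe]
  rfl

theorem wnorm_mul_le (h : ∀ α β, w (α + β) ≤ w₁ α * w₂ β) (p q : FormalSeries) :
    wnorm w (p * q) ≤ wnorm w₁ p * wnorm w₂ q := by
  rw [wnorm, wnorm, wnorm, ← ENNReal.tsum_mul_tsum_antidiagonal]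
  refine ENNReal.tsum_le_tsum fun α => ?_
  rw [coeff_mul]
  calc w α * ‖∑ x ∈ antidiagonal α, coeff x.1 p * coeff x.2 q‖ₑ
      ≤ w α * ∑ x ∈ antidiagonal α, ‖coeff x.1 p * coeff x.2 q‖ₑ := by
        gcongr
        exact enorm_sum_le _ _
    _ = ∑ x ∈ antidiagonal α, w α * ‖coeff x.1 p * coeff x.2 q‖ₑ := Finset.mul_sum _ _ _
    _ ≤ _ := by
        refine Finset.sum_le_sum fun x hx => ?_
        rw [enorm_mul, ← mem_antidiagonal.mp hx]
        calc w (x.1 + x.2) * (‖coeff x.1 p‖ₑ * ‖coeff x.2 q‖ₑ)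
            ≤ w₁ x.1 * w₂ x.2 * (‖coeff x.1 p‖ₑ * ‖coeff x.2 q‖ₑ) := by
              gcongr
              exact h _ _
          _ = _ := by ring

theorem wnorm_pderiv_le {i : Fin 3}
    (h : ∀ α, w₁ α * (α i + 1 : ℕ) ≤ w₂ (α + Finsupp.single i 1)) (p : FormalSeries) :
    wnorm w₁ (pderiv ℝ i p) ≤ wnorm w₂ p := by
  have hinj : Function.Injective fun α : Fin 3 →₀ ℕ => α + Finsupp.single i 1 :=
    add_left_injective _
  refine le_trans (ENNReal.tsum_le_tsum fun α => ?_)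
    (ENNReal.tsum_comp_le_tsum_of_injective hinj fun α => w₂ α * ‖coeff α p‖ₑ)
  have e : ‖((α i : ℝ) + 1)‖ₑ = ((α i + 1 : ℕ) : ENNReal) := by
    rw [← Nat.cast_succ, Real.enorm_natCast]
  rw [coeff_pderiv, enorm_mul, e, mul_comm ‖_‖ₑ, ← mul_assoc]
  gcongr
  exact h α

/-- The formal primitive in the variable `x¹` that vanishes at `x¹ = 0`. -/
def primitive (p : FormalSeries) : FormalSeries := fun α =>
  if α 0 = 0 then 0 else coeff (α - Finsupp.single 0 1) p / α 0

theorem coeff_primitive (p : FormalSeries) (α : Fin 3 →₀ ℕ) :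
    coeff α (primitive p) =
      if α 0 = 0 then 0 else coeff (α - Finsupp.single 0 1) p / α 0 := rfl

theorem coeff_primitive_add_single (p : FormalSeries) (α : Fin 3 →₀ ℕ) :
    coeff (α + Finsupp.single 0 1) (primitive p) = coeff α p / (α 0 + 1) := by
  simp [coeff_primitive]

theorem pderiv_primitive (p : FormalSeries) : pderiv ℝ 0 (primitive p) = p := by
  ext α
  rw [coeff_pderiv, coeff_primitive_add_single]
  field_simp

theorem primitive_sub (p q : FormalSeries) : primitive (p - q) = primitive p - primitive q := by
  ext α
  simp only [coeff_primitive, map_sub]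
  split_ifs <;> ring

theorem X_dvd_primitive (p : FormalSeries) : (X 0 : FormalSeries) ∣ primitive p := by
  rw [X_dvd_iff]
  intro α h
  simp [coeff_primitive, h]

theorem X_pow_dvd_primitive {n : ℕ} {p : FormalSeries} (h : (X 0 : FormalSeries) ^ n ∣ p) :
    (X 0 : FormalSeries) ^ (n + 1) ∣ primitive p := by
  rw [X_pow_dvd_iff] at h ⊢
  intro α hα
  rw [coeff_primitive]
  split_ifs with h0
  · rfl
  · rw [h _ (by simp; omega), zero_div]

theorem X_pow_dvd_pderiv {n : ℕ} {p : FormalSeries} {i : Fin 3} (hi : i ≠ 0)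
    (h : (X 0 : FormalSeries) ^ n ∣ p) : (X 0 : FormalSeries) ^ n ∣ pderiv ℝ i p := by
  rw [X_pow_dvd_iff] at h ⊢
  intro α hα
  rw [coeff_pderiv, h _ (by simpa [Finsupp.single_apply, hi] using hα), zero_mul]

theorem wnorm_primitive_le {c : ENNReal}
    (h : ∀ α, w₂ (α + Finsupp.single 0 1) ≤ c * w₁ α * (α 0 + 1 : ℕ)) (p : FormalSeries) :
    wnorm w₂ (primitive p) ≤ c * wnorm w₁ p := by
  have hinj : Function.Injective fun α : Fin 3 →₀ ℕ => α + Finsupp.single 0 1 :=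
    add_left_injective _
  have hs : Function.support (fun α => w₂ α * ‖coeff α (primitive p)‖ₑ) ⊆
      Set.range fun α : Fin 3 →₀ ℕ => α + Finsupp.single 0 1 := by
    intro α hα
    by_cases h0 : α 0 = 0
    · simp [coeff_primitive, h0] at hα
    · refine ⟨α - Finsupp.single 0 1, tsub_add_cancel_of_le ?_⟩
      rw [Finsupp.single_le_iff]
      omega
  rw [wnorm, ← hinj.tsum_eq hs, wnorm, ← ENNReal.tsum_mul_left]
  refine ENNReal.tsum_le_tsum fun α => ?_
  have e : ‖((α 0 : ℝ) + 1)‖ₑ = ((α 0 + 1 : ℕ) : ENNReal) := by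
    rw [← Nat.cast_succ, Real.enorm_natCast]
  have e2 : ‖coeff α p‖ₑ =
      ((α 0 + 1 : ℕ) : ENNReal) * ‖coeff (α + Finsupp.single 0 1) (primitive p)‖ₑ := by
    rw [← e, ← enorm_mul, coeff_primitive_add_single]
    congr 1
    field_simp
  rw [e2, ← mul_assoc, ← mul_assoc]
  gcongr
  exact h α

end wnorm

/-! ### The algebra weights and the derivative weights -/

theorem Nat.choose_mul_choose_le_choose_add (a b m n : ℕ) :
    (a + m).choose a * (b + n).choose b ≤ (a + b + (m + n)).choose (a + b) := by
  -- By Vandermonde's identity the left side is one term of a sum equal to the right side.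
  rw [show a + b + (m + n) = (a + m) + (b + n) by ring, Nat.add_choose_eq (a + m) (b + n)]
  exact Finset.single_le_sum
    (f := fun ij : ℕ × ℕ => (a + m).choose ij.1 * (b + n).choose ij.2)
    (fun _ _ => Nat.zero_le _) (mem_antidiagonal.mpr (rfl : (a, b).1 + (a, b).2 = a + b))

/-- The weights of the algebra norm. They depend on the order `a` in `x¹` and on the total order
`m` in `x², x³`. -/
def weight (r ρ : ℝ) (α : Fin 3 →₀ ℕ) : ENNReal :=
  ENNReal.ofReal (r ^ (α 0 + (α 1 + α 2)) * ρ ^ α 0 / (α 0 + (α 1 + α 2)).choose (α 0))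

/-- The weights of the norm in which first derivatives are measured. -/
def weightD (r ρ : ℝ) (α : Fin 3 →₀ ℕ) : ENNReal :=
  ENNReal.ofReal (r ^ (α 0 + (α 1 + α 2) + 1) * ρ ^ α 0 /
    ((α 0 + (α 1 + α 2) + 1 : ℕ) * (α 0 + (α 1 + α 2)).choose (α 0)))

section weight

variable {r ρ : ℝ}

/-- The binomial coefficient sits in the denominator, so its supermultiplicativity makes the weight
submultiplicative and the norm an algebra norm. -/
theorem weight_add_le (hr : 0 < r) (hρ : 0 < ρ) (α β : Fin 3 →₀ ℕ) :
    weight r ρ (α + β) ≤ weight r ρ α * weight r ρ β := by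
  rw [weight, weight, weight, ← ENNReal.ofReal_mul (by positivity)]
  refine ENNReal.ofReal_le_ofReal ?_
  simp only [Finsupp.add_apply]
  have h := Nat.choose_mul_choose_le_choose_add (α 0) (β 0) (α 1 + α 2) (β 1 + β 2)
  have e : α 0 + β 0 + (α 1 + β 1 + (α 2 + β 2)) = α 0 + β 0 + (α 1 + α 2 + (β 1 + β 2)) := by ring
  rw [e, div_mul_div_comm]
  have h1 : 0 < (α 0 + (α 1 + α 2)).choose (α 0) := Nat.choose_pos (by omega)
  have h2 : 0 < (β 0 + (β 1 + β 2)).choose (β 0) := Nat.choose_pos (by omega)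
  refine div_le_div₀ (by positivity) (le_of_eq (by ring)) (by positivity) ?_
  exact_mod_cast h

/-- This makes the `weightD`-norm a module norm over the `weight`-algebra. The extra factor `|β| +
1` in the denominator only grows when `β` is replaced by `α + β`. -/
theorem weightD_add_le (hr : 0 < r) (hρ : 0 < ρ) (α β : Fin 3 →₀ ℕ) :
    weightD r ρ (α + β) ≤ weight r ρ α * weightD r ρ β := by
  rw [weight, weightD, weightD, ← ENNReal.ofReal_mul (by positivity)]
  refine ENNReal.ofReal_le_ofReal ?_
  simp only [Finsupp.add_apply]
  have h := Nat.choose_mul_choose_le_choose_add (α 0) (β 0) (α 1 + α 2) (β 1 + β 2)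
  have e : α 0 + β 0 + (α 1 + β 1 + (α 2 + β 2)) = α 0 + β 0 + (α 1 + α 2 + (β 1 + β 2)) := by ring
  rw [e, div_mul_div_comm]
  have h1 : 0 < (α 0 + (α 1 + α 2)).choose (α 0) := Nat.choose_pos (by omega)
  have h2 : 0 < (β 0 + (β 1 + β 2)).choose (β 0) := Nat.choose_pos (by omega)
  refine div_le_div₀ (by positivity) (le_of_eq (by ring)) (by positivity) ?_
  have h3 : β 0 + (β 1 + β 2) + 1 ≤ α 0 + β 0 + (α 1 + α 2 + (β 1 + β 2)) + 1 := by omega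
  have h4 := Nat.mul_le_mul h3 h
  rw [show ((α 0 + (α 1 + α 2)).choose (α 0) : ℝ) *
    ((β 0 + (β 1 + β 2) + 1 : ℕ) * (β 0 + (β 1 + β 2)).choose (β 0)) =
    (β 0 + (β 1 + β 2) + 1 : ℕ) * ((α 0 + (α 1 + α 2)).choose (α 0) *
      (β 0 + (β 1 + β 2)).choose (β 0)) by ring]
  exact_mod_cast h4

theorem weightD_le_weight (hr : 0 < r) (hr1 : r ≤ 1) (hρ : 0 < ρ) (α : Fin 3 →₀ ℕ) :
    weightD r ρ α ≤ weight r ρ α := by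
  refine ENNReal.ofReal_le_ofReal ?_
  have h1 : 0 < (α 0 + (α 1 + α 2)).choose (α 0) := Nat.choose_pos (by omega)
  refine div_le_div₀ (by positivity) ?_ (by positivity) ?_
  · gcongr ?_ * _
    exact pow_le_pow_of_le_one hr.le hr1 (Nat.le_succ _)
  · refine le_mul_of_one_le_left (by positivity) ?_
    exact_mod_cast Nat.le_add_left 1 _

/-- With `a` the order in `x¹` and `m` the order in `x², x³`, the identity `(a + m + 1) C(a + m, a)
= (m + 1) C(a + m + 1, a)` absorbs the factor `α i + 1 ≤ m + 1` produced by a tangential derivative.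
-/
theorem weightD_mul_le (hr : 0 < r) (hρ : 0 < ρ) {i : Fin 3} (hi : i ≠ 0) (α : Fin 3 →₀ ℕ) :
    weightD r ρ α * (α i + 1 : ℕ) ≤ weight r ρ (α + Finsupp.single i 1 : Fin 3 →₀ ℕ) := by
  have h0 : (α + Finsupp.single i 1 : Fin 3 →₀ ℕ) 0 = α 0 := by simp [hi]
  have h12 : (α + Finsupp.single i 1 : Fin 3 →₀ ℕ) 1 +
      (α + Finsupp.single i 1 : Fin 3 →₀ ℕ) 2 = α 1 + α 2 + 1 := by
    fin_cases i
    · exact absurd rfl hi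
    · simp; ring
    · simp; ring
  have hle : α i ≤ α 1 + α 2 := by
    fin_cases i
    · exact absurd rfl hi
    · simp
    · simp
  rw [weight, weightD, h0, h12, ← ENNReal.ofReal_natCast, ← ENNReal.ofReal_mul (by positivity)]
  refine ENNReal.ofReal_le_ofReal ?_
  generalize α 1 + α 2 = m at *
  generalize α 0 = a at *
  have h1 : 0 < (a + m).choose a := Nat.choose_pos (by omega)
  have h2 : 0 < (a + (m + 1)).choose a := Nat.choose_pos (by omega)
  have key : (a + m + 1) * (a + m).choose a = (a + (m + 1)).choose a * (m + 1) := by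
    have := Nat.add_one_mul_choose_eq (a + m) m
    rwa [← Nat.choose_symm_add, add_assoc, ← Nat.choose_symm_add, ← add_assoc] at this
  have key' : ((a + m + 1 : ℕ) : ℝ) * (a + m).choose a = (a + (m + 1)).choose a * (m + 1 : ℕ) := by
    exact_mod_cast key
  rw [key', div_mul_eq_mul_div, div_le_div_iff₀ (by positivity) (by positivity)]
  have hle' : ((α i + 1 : ℕ) : ℝ) ≤ (m + 1 : ℕ) := by exact_mod_cast Nat.succ_le_succ hle
  calc r ^ (a + m + 1) * ρ ^ a * (α i + 1 : ℕ) * (a + (m + 1)).choose a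
      ≤ r ^ (a + m + 1) * ρ ^ a * (m + 1 : ℕ) * (a + (m + 1)).choose a := by gcongr
    _ = _ := by ring

/-- Here `(a + m + 1) C(a + m, a) = (a + 1) C(a + m + 1, a + 1)` gives equality of the two sides.
The gain `ρ` comes from the one additional power of `x¹`; it is the small parameter of the existence
proof. -/
theorem weight_add_single (hr : 0 < r) (hρ : 0 < ρ) (α : Fin 3 →₀ ℕ) :
    weight r ρ (α + Finsupp.single 0 1) ≤ ENNReal.ofReal ρ * weightD r ρ α * (α 0 + 1 : ℕ) := by
  have h0 : (α + Finsupp.single 0 1 : Fin 3 →₀ ℕ) 0 = α 0 + 1 := by simp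
  have h12 : (α + Finsupp.single 0 1 : Fin 3 →₀ ℕ) 1 +
      (α + Finsupp.single 0 1 : Fin 3 →₀ ℕ) 2 = α 1 + α 2 := by
    simp
  rw [weight, weightD, h0, h12, ← ENNReal.ofReal_natCast, ← ENNReal.ofReal_mul (by positivity),
    ← ENNReal.ofReal_mul (by positivity)]
  refine ENNReal.ofReal_le_ofReal (le_of_eq ?_)
  generalize α 1 + α 2 = m at *
  generalize α 0 = a at *
  have h1 : 0 < (a + m).choose a := Nat.choose_pos (by omega)
  have h2 : 0 < (a + 1 + m).choose (a + 1) := Nat.choose_pos (by omega)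
  have key : (a + m + 1) * (a + m).choose a = (a + 1 + m).choose (a + 1) * (a + 1) := by
    have := Nat.add_one_mul_choose_eq (a + m) a
    rwa [show a + m + 1 = a + 1 + m by ring] at this ⊢
  have key' : ((a + m + 1 : ℕ) : ℝ) * (a + m).choose a =
      (a + 1 + m).choose (a + 1) * (a + 1 : ℕ) := by
    exact_mod_cast key
  rw [key']
  field_simp
  ring

theorem weight_mono (hr : 0 < r) (hρ : 0 < ρ) (hρ1 : ρ ≤ 1) (α : Fin 3 →₀ ℕ) :
    weight r ρ α ≤ weight r 1 α := by
  refine ENNReal.ofReal_le_ofReal ?_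
  have h1 : 0 < (α 0 + (α 1 + α 2)).choose (α 0) := Nat.choose_pos (by omega)
  gcongr

end weight

/-! ### Convergent power series -/

/-- The weights of absolute convergence on the polydisc of radius `r`. -/
def polyWeight (r : ℝ) (α : Fin 3 →₀ ℕ) : ENNReal :=
  ENNReal.ofReal (r ^ (α 0 + (α 1 + α 2)))

/-- A formal power series that converges absolutely on some polydisc. -/
def IsConvergent (p : FormalSeries) : Prop :=
  ∃ r : ℝ, 0 < r ∧ wnorm (polyWeight r) p ≠ ⊤

theorem isConvergent_one : IsConvergent 1 := by
  refine ⟨1, one_pos, ?_⟩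
  rw [wnorm, tsum_eq_single 0 fun α hα => by simp [coeff_one, hα]]
  simp [polyWeight]

theorem IsConvergent.eventually_polyWeight {p : FormalSeries} (h : IsConvergent p) :
    ∀ᶠ r in 𝓝[>] (0 : ℝ), wnorm (polyWeight r) p ≠ ⊤ := by
  obtain ⟨s, hs, hp⟩ := h
  filter_upwards [Ioo_mem_nhdsGT hs] with r hr
  refine ne_top_of_le_ne_top hp ?_
  refine (wnorm_mono (c := 1) (fun α => ?_) p).trans_eq (one_mul _)
  rw [one_mul]
  exact ENNReal.ofReal_le_ofReal (pow_le_pow_left₀ hr.1.le hr.2.le _)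

theorem IsConvergent.eventually {p : FormalSeries} (h : IsConvergent p) :
    ∀ᶠ r in 𝓝[>] (0 : ℝ), wnorm (weight r 1) p ≠ ⊤ := by
  filter_upwards [h.eventually_polyWeight, self_mem_nhdsWithin] with r hp hr
  refine ne_top_of_le_ne_top hp ?_
  refine (wnorm_mono (c := 1) (fun α => ?_) p).trans_eq (one_mul _)
  rw [one_mul]
  refine ENNReal.ofReal_le_ofReal ?_
  have h1 : 1 ≤ (α 0 + (α 1 + α 2)).choose (α 0) := Nat.choose_pos (by omega)
  rw [one_pow, mul_one]
  exact div_le_self (pow_nonneg (le_of_lt hr) _) (by exact_mod_cast h1)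

theorem isConvergent_of_wnorm_weight {r ρ : ℝ} (hr : 0 < r) (hρ : 0 < ρ) (hρ1 : ρ ≤ 1)
    {p : FormalSeries} (h : wnorm (weight r ρ) p ≠ ⊤) : IsConvergent p := by
  -- The factor `1/2` per degree pays for the binomial coefficient, which is at most `2 ^ |α|`, and
  -- `ρ ^ |α| ≤ ρ ^ α 0` since `ρ ≤ 1`.
  refine ⟨r * ρ / 2, by positivity, ne_top_of_le_ne_top h ?_⟩
  refine (wnorm_mono (c := 1) (fun α => ?_) p).trans_eq (one_mul _)
  rw [one_mul]
  refine ENNReal.ofReal_le_ofReal ?_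
  have h1 : 0 < (α 0 + (α 1 + α 2)).choose (α 0) := Nat.choose_pos (by omega)
  have h2 : (α 0 + (α 1 + α 2)).choose (α 0) ≤ 2 ^ (α 0 + (α 1 + α 2)) :=
    Nat.choose_le_two_pow _ _
  have h2' : ((α 0 + (α 1 + α 2)).choose (α 0) : ℝ) ≤ 2 ^ (α 0 + (α 1 + α 2)) := by
    exact_mod_cast h2
  rw [div_pow, mul_pow]
  refine div_le_div₀ (by positivity) ?_ (by positivity) h2'
  gcongr ?_ * ?_
  exact pow_le_pow_of_le_one hρ.le hρ1 (by omega)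

/-! ### Tame operators -/

section tameness

variable {ι : Type*}

/-- An operator `F` on families of formal power series that respects congruences modulo powers of
`x¹`, and that maps `weight r ρ`-bounded sets to `W r ρ`-bounded sets, uniformly in `ρ ≤ 1`. -/
structure IsTameAt (W : ℝ → ℝ → (Fin 3 →₀ ℕ) → ENNReal) (r : ℝ)
    (F : (ι → FormalSeries) → FormalSeries) : Prop where
  congr : ∀ n u v, (∀ i, (X 0 : FormalSeries) ^ n ∣ u i - v i) →
    (X 0 : FormalSeries) ^ n ∣ F u - F v
  bound : ∀ R : ENNReal, R ≠ ⊤ → ∃ K : ENNReal, K ≠ ⊤ ∧ ∀ ρ : ℝ, 0 < ρ → ρ ≤ 1 → ∀ u,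
    (∀ i, wnorm (weight r ρ) (u i) ≤ R) → wnorm (W r ρ) (F u) ≤ K

/-- Tameness for all sufficiently small radii. -/
def IsTame (W : ℝ → ℝ → (Fin 3 →₀ ℕ) → ENNReal) (F : (ι → FormalSeries) → FormalSeries) : Prop :=
  ∀ᶠ r in 𝓝[>] (0 : ℝ), IsTameAt W r F

section IsTame

variable {W : ℝ → ℝ → (Fin 3 →₀ ℕ) → ENNReal} {F G : (ι → FormalSeries) → FormalSeries}

theorem isTame_const {p : FormalSeries} (hp : IsConvergent p) :
    IsTame weight fun _ : ι → FormalSeries => p := by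
  filter_upwards [hp.eventually, self_mem_nhdsWithin] with r hr hr0
  refine ⟨fun n u v _ => by simp, fun R _ => ⟨_, hr, fun ρ hρ hρ1 u _ => ?_⟩⟩
  refine (wnorm_mono (c := 1) (fun α => ?_) p).trans_eq (one_mul _)
  rw [one_mul]
  exact weight_mono hr0 hρ hρ1 α

theorem isTame_apply (i : ι) : IsTame weight fun u : ι → FormalSeries => u i :=
  Eventually.of_forall fun _ =>
    ⟨fun _ _ _ h => h i, fun R hR => ⟨R, hR, fun _ _ _ _ h => h i⟩⟩

/-- Only tangential derivatives qualify: `∂₁` would lower the order in `x¹` by one. -/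
theorem isTame_pderiv_apply (i : ι) {k : Fin 3} (hk : k ≠ 0) :
    IsTame weightD fun u : ι → FormalSeries => pderiv ℝ k (u i) := by
  filter_upwards [self_mem_nhdsWithin] with r hr
  refine ⟨fun n u v h => ?_, fun R hR => ⟨R, hR, fun ρ hρ _ u h => ?_⟩⟩
  · rw [← map_sub]
    exact X_pow_dvd_pderiv hk (h i)
  · exact (wnorm_pderiv_le (weightD_mul_le hr hρ hk) _).trans (h i)

theorem IsTame.add (hF : IsTame W F) (hG : IsTame W G) : IsTame W fun u => F u + G u := by
  filter_upwards [hF, hG] with r hF hG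
  refine ⟨fun n u v h => ?_, fun R hR => ?_⟩
  · rw [add_sub_add_comm]
    exact dvd_add (hF.congr n u v h) (hG.congr n u v h)
  · obtain ⟨K, hK, hF⟩ := hF.bound R hR
    obtain ⟨L, hL, hG⟩ := hG.bound R hR
    exact ⟨K + L, ENNReal.add_ne_top.mpr ⟨hK, hL⟩, fun ρ hρ hρ1 u h =>
      (wnorm_add_le _ _).trans (add_le_add (hF ρ hρ hρ1 u h) (hG ρ hρ hρ1 u h))⟩

theorem IsTame.neg (hF : IsTame W F) : IsTame W fun u => -F u := by
  filter_upwards [hF] with r hF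
  refine ⟨fun n u v h => ?_, fun R hR => ?_⟩
  · rw [← neg_sub', dvd_neg]
    exact hF.congr n u v h
  · obtain ⟨K, hK, hF⟩ := hF.bound R hR
    exact ⟨K, hK, fun ρ hρ hρ1 u h => (wnorm_neg _).trans_le (hF ρ hρ hρ1 u h)⟩

theorem IsTame.sub (hF : IsTame W F) (hG : IsTame W G) : IsTame W fun u => F u - G u := by
  simpa only [sub_eq_add_neg] using hF.add hG.neg

/-- The hypothesis on `W` says that the `W`-norm is a module norm over the algebra normed by
`weight`; it covers both weight families. -/
theorem IsTame.mul_of_weight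
    (hW : ∀ r ρ : ℝ, 0 < r → 0 < ρ → ∀ α β, W r ρ (α + β) ≤ weight r ρ α * W r ρ β)
    (hF : IsTame weight F) (hG : IsTame W G) : IsTame W fun u => F u * G u := by
  filter_upwards [hF, hG, self_mem_nhdsWithin] with r hF hG hr
  refine ⟨fun n u v h => ?_, fun R hR => ?_⟩
  · rw [show F u * G u - F v * G v = F u * (G u - G v) + G v * (F u - F v) by ring]
    exact dvd_add (Dvd.dvd.mul_left (hG.congr n u v h) _) (Dvd.dvd.mul_left (hF.congr n u v h) _)
  · obtain ⟨K, hK, hF⟩ := hF.bound R hR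
    obtain ⟨L, hL, hG⟩ := hG.bound R hR
    exact ⟨K * L, ENNReal.mul_ne_top hK hL, fun ρ hρ hρ1 u h =>
      (wnorm_mul_le (hW r ρ hr hρ) _ _).trans (mul_le_mul' (hF ρ hρ hρ1 u h) (hG ρ hρ hρ1 u h))⟩

theorem IsTame.mul (hF : IsTame weight F) (hG : IsTame weight G) :
    IsTame weight fun u => F u * G u :=
  hF.mul_of_weight (fun _ _ => weight_add_le) hG

/-- Only one factor may be measured by `weightD`, that is, may contain derivatives. This suffices
for quasilinear systems. -/
theorem IsTame.mulD (hF : IsTame weight F) (hG : IsTame weightD G) :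
    IsTame weightD fun u => F u * G u :=
  hF.mul_of_weight (fun _ _ => weightD_add_le) hG

theorem IsTame.pow (hF : IsTame weight F) (n : ℕ) : IsTame weight fun u => F u ^ n := by
  induction n with
  | zero =>
    simp only [pow_zero]
    exact isTame_const isConvergent_one
  | succ n ih => simpa only [pow_succ] using ih.mul hF

theorem IsTame.weightD (hF : IsTame weight F) : IsTame weightD F := by
  -- The comparison of the two weights needs `r ≤ 1`, which is harmless since tameness concerns
  -- small radii only.
  filter_upwards [hF, Ioo_mem_nhdsGT one_pos] with r hF hr
  refine ⟨hF.congr, fun R hR => ?_⟩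
  obtain ⟨K, hK, hF⟩ := hF.bound R hR
  refine ⟨K, hK, fun ρ hρ hρ1 u h => le_trans ?_ (hF ρ hρ hρ1 u h)⟩
  refine (wnorm_mono (c := 1) (fun α => ?_) _).trans_eq (one_mul _)
  rw [one_mul]
  exact weightD_le_weight hr.1 hr.2.le hρ α

end IsTame

/-! ### Picard iteration -/

/-- The iterates of the integral operator `u ↦ u₀ + ∫ F(u) dx¹`. -/
def picardSeq (F : ι → (ι → FormalSeries) → FormalSeries) (u₀ : ι → FormalSeries) :
    ℕ → ι → FormalSeries
  | 0 => u₀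
  | n + 1 => fun i => u₀ i + primitive (F i (picardSeq F u₀ n))

/-- The limit of the iterates, coefficient by coefficient. -/
def picardLimit (F : ι → (ι → FormalSeries) → FormalSeries) (u₀ : ι → FormalSeries) :
    ι → FormalSeries :=
  fun i α => coeff α (picardSeq F u₀ (α 0 + 1) i)

section picard

variable {F : ι → (ι → FormalSeries) → FormalSeries}

/-- Operators that respect congruences modulo powers of `x¹`. -/
def RespectsOrder (F : ι → (ι → FormalSeries) → FormalSeries) : Prop :=
  ∀ i n u v, (∀ j, (X 0 : FormalSeries) ^ n ∣ u j - v j) → (X 0 : FormalSeries) ^ n ∣ F i u - F i v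

/-- Integration in `x¹` raises the order of agreement by one. This replaces a contraction estimate:
convergence of the iterates is `x¹`-adic, and norms are needed only for boundedness. -/
theorem RespectsOrder.step (hF : RespectsOrder F) (u₀ : ι → FormalSeries) {n : ℕ}
    {u v : ι → FormalSeries} (h : ∀ j, (X 0 : FormalSeries) ^ n ∣ u j - v j) (i : ι) :
    (X 0 : FormalSeries) ^ (n + 1) ∣
      (u₀ i + primitive (F i u)) - (u₀ i + primitive (F i v)) := by
  rw [add_sub_add_left_eq_sub, ← primitive_sub]
  exact X_pow_dvd_primitive (hF i n u v h)

theorem X_pow_dvd_picardSeq_succ_sub (hF : RespectsOrder F) (u₀ : ι → FormalSeries) (n : ℕ)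
    (i : ι) : (X 0 : FormalSeries) ^ n ∣ picardSeq F u₀ (n + 1) i - picardSeq F u₀ n i := by
  induction n generalizing i with
  | zero => simp
  | succ n ih => exact hF.step u₀ ih i

theorem X_pow_dvd_picardSeq_sub (hF : RespectsOrder F) (u₀ : ι → FormalSeries) {m n : ℕ}
    (h : n ≤ m) (i : ι) : (X 0 : FormalSeries) ^ n ∣ picardSeq F u₀ m i - picardSeq F u₀ n i := by
  induction m, h using Nat.le_induction with
  | base => simp
  | succ m hm ih =>
    rw [← sub_add_sub_cancel _ (picardSeq F u₀ m i)]
    exact dvd_add ((pow_dvd_pow _ hm).trans (X_pow_dvd_picardSeq_succ_sub hF u₀ m i)) ih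

theorem coeff_picardLimit (hF : RespectsOrder F) (u₀ : ι → FormalSeries) {n : ℕ}
    {α : Fin 3 →₀ ℕ} (h : α 0 < n) (i : ι) :
    coeff α (picardLimit F u₀ i) = coeff α (picardSeq F u₀ n i) := by
  have := X_pow_dvd_iff.mp (X_pow_dvd_picardSeq_sub hF u₀ h i) α (Nat.lt_succ_self _)
  rw [map_sub, sub_eq_zero] at this
  exact this.symm

theorem X_pow_dvd_picardLimit_sub (hF : RespectsOrder F) (u₀ : ι → FormalSeries) (n : ℕ) (i : ι) :
    (X 0 : FormalSeries) ^ n ∣ picardLimit F u₀ i - picardSeq F u₀ n i := by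
  rw [X_pow_dvd_iff]
  intro α hα
  rw [map_sub, coeff_picardLimit hF u₀ hα, sub_self]

theorem eq_zero_of_forall_X_pow_dvd {p : FormalSeries}
    (h : ∀ n, (X 0 : FormalSeries) ^ n ∣ p) : p = 0 := by
  ext α
  exact X_pow_dvd_iff.mp (h (α 0 + 1)) α (Nat.lt_succ_self _)

theorem picardLimit_eq (hF : RespectsOrder F) (u₀ : ι → FormalSeries) (i : ι) :
    picardLimit F u₀ i = u₀ i + primitive (F i (picardLimit F u₀)) := by
  refine sub_eq_zero.mp (eq_zero_of_forall_X_pow_dvd fun n => ?_)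
  rw [← sub_sub_sub_cancel_right _ _ (picardSeq F u₀ (n + 1) i)]
  refine (pow_dvd_pow _ n.le_succ).trans (dvd_sub (X_pow_dvd_picardLimit_sub hF u₀ _ i) ?_)
  exact hF.step u₀ (X_pow_dvd_picardLimit_sub hF u₀ n) i

/-- A Fatou argument: a finite partial sum of the norm of the limit involves finitely many
coefficients, and these agree with those of a sufficiently late iterate. -/
theorem wnorm_picardLimit_le (hF : RespectsOrder F) (u₀ : ι → FormalSeries)
    {w : (Fin 3 →₀ ℕ) → ENNReal} {R : ENNReal} {i : ι}
    (h : ∀ n, wnorm w (picardSeq F u₀ n i) ≤ R) : wnorm w (picardLimit F u₀ i) ≤ R := by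
  refine ENNReal.summable.tsum_le_of_sum_le fun s => ?_
  obtain ⟨N, hN⟩ : ∃ N, ∀ α ∈ s, α 0 < N :=
    ⟨s.sup (fun α => α 0) + 1, fun α hα =>
      Nat.lt_succ_of_le (Finset.le_sup (f := fun α : Fin 3 →₀ ℕ => α 0) hα)⟩
  refine le_trans ?_ ((ENNReal.sum_le_tsum s).trans (h N))
  refine Finset.sum_le_sum fun α hα => ?_
  rw [coeff_picardLimit hF u₀ (hN α hα)]

/-- Existence of convergent solutions of `u = u₀ + ∫ F(u) dx¹`. -/
theorem exists_isConvergent_eq_add_primitive [Finite ι] (hF : ∀ i, IsTame weightD (F i))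
    {u₀ : ι → FormalSeries} (hu₀ : ∀ i, IsConvergent (u₀ i)) :
    ∃ u : ι → FormalSeries, ∀ i, IsConvergent (u i) ∧ u i = u₀ i + primitive (F i u) := by
  have := Fintype.ofFinite ι
  obtain ⟨r, hr, hFr, hur⟩ := ((eventually_mem_nhdsWithin (a := (0 : ℝ)) (s := Set.Ioi 0)).and
    ((eventually_all.mpr hF).and (eventually_all.mpr fun i => (hu₀ i).eventually))).exists
  have hO : RespectsOrder F := fun i => (hFr i).congr
  -- The radius of the invariant ball leaves room `1` beyond the initial data for the integral term.
  set R : ENNReal := ∑ i, wnorm (weight r 1) (u₀ i) + 1 with hR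
  have hRtop : R ≠ ⊤ :=
    ENNReal.add_ne_top.mpr ⟨ENNReal.sum_ne_top.mpr fun i _ => hur i, ENNReal.one_ne_top⟩
  choose K hK hKF using fun i => (hFr i).bound R hRtop
  set L : ENNReal := ∑ i, K i with hL
  have hLtop : L ≠ ⊤ := ENNReal.sum_ne_top.mpr fun i _ => hK i
  -- The bounds `K i` do not depend on `ρ`, so `ρ` can be chosen afterwards with `ρ L ≤ 1`; the
  -- integral term then has norm at most `1`.
  set ρ : ℝ := 1 / (L.toReal + 1) with hρdef
  have hLnn : 0 ≤ L.toReal := ENNReal.toReal_nonneg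
  have hρ : 0 < ρ := by positivity
  have hρ1 : ρ ≤ 1 := by
    rw [hρdef, div_le_one (by positivity)]
    linarith
  have hρL : ENNReal.ofReal ρ * L ≤ 1 := by
    rw [← ENNReal.ofReal_toReal hLtop, ← ENNReal.ofReal_mul hρ.le, ENNReal.ofReal_le_one, hρdef,
      one_div, inv_mul_le_one₀ (by positivity)]
    linarith
  have hu₀R : ∀ i, wnorm (weight r ρ) (u₀ i) ≤ ∑ i, wnorm (weight r 1) (u₀ i) := fun i => by
    refine le_trans ?_ (Finset.single_le_sum (fun _ _ => zero_le) (mem_univ i))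
    refine (wnorm_mono (c := 1) (fun α => ?_) _).trans_eq (one_mul _)
    rw [one_mul]
    exact weight_mono hr hρ hρ1 α
  have hbound : ∀ n i, wnorm (weight r ρ) (picardSeq F u₀ n i) ≤ R := by
    intro n
    induction n with
    | zero => exact fun i => (hu₀R i).trans le_self_add
    | succ n ih =>
      intro i
      refine (wnorm_add_le _ _).trans (add_le_add (hu₀R i) ?_)
      refine (wnorm_primitive_le (weight_add_single hr hρ) _).trans (le_trans ?_ hρL)
      gcongr
      exact (hKF i ρ hρ hρ1 _ ih).trans (Finset.single_le_sum (fun _ _ => zero_le) (mem_univ i))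
  refine ⟨picardLimit F u₀, fun i => ⟨?_, picardLimit_eq hO u₀ i⟩⟩
  exact isConvergent_of_wnorm_weight hr hρ hρ1
    (ne_top_of_le_ne_top hRtop (wnorm_picardLimit_le hO u₀ fun n => hbound n i))

end picard

end tameness

/-! ### Sums of convergent power series -/

/-- The monomial function `x ^ α`. -/
def monomialFun (α : Fin 3 →₀ ℕ) (x : R3) : ℝ := x 0 ^ α 0 * (x 1 ^ α 1 * x 2 ^ α 2)

theorem monomialFun_add (α β : Fin 3 →₀ ℕ) (x : R3) :
    monomialFun (α + β) x = monomialFun α x * monomialFun β x := by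
  simp only [monomialFun, Finsupp.add_apply]
  ring

@[simp]
theorem monomialFun_zero (x : R3) : monomialFun 0 x = 1 := by simp [monomialFun]

theorem abs_monomialFun_le (α : Fin 3 →₀ ℕ) {x : R3} {r : ℝ} (hx : ‖x‖ ≤ r) :
    |monomialFun α x| ≤ r ^ (α 0 + (α 1 + α 2)) := by
  have h : ∀ i, |x i| ≤ r := fun i => (norm_le_pi_norm x i).trans hx
  have hr : 0 ≤ r := (norm_nonneg x).trans hx
  rw [monomialFun, abs_mul, abs_mul, abs_pow, abs_pow, abs_pow, pow_add, pow_add]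
  gcongr <;> exact h _

/-- The sum of a power series. -/
def seriesSum (p : FormalSeries) (x : R3) : ℝ := ∑' α, coeff α p * monomialFun α x

theorem wnorm_polyWeight_ne_top_iff {p : FormalSeries} {r : ℝ} (hr : 0 ≤ r) :
    wnorm (polyWeight r) p ≠ ⊤ ↔
      Summable fun α : Fin 3 →₀ ℕ => |coeff α p| * r ^ (α 0 + (α 1 + α 2)) := by
  have h : wnorm (polyWeight r) p =
      ∑' α : Fin 3 →₀ ℕ,
        ((‖coeff α p‖₊ * (r ^ (α 0 + (α 1 + α 2))).toNNReal : NNReal) : ENNReal) := by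
    refine tsum_congr fun α => ?_
    rw [ENNReal.coe_mul, mul_comm]
    rfl
  rw [h, ENNReal.tsum_coe_ne_top_iff_summable, ← NNReal.summable_coe]
  refine summable_congr fun α => ?_
  rw [NNReal.coe_mul, Real.coe_toNNReal _ (by positivity)]
  rfl

theorem summable_abs_coeff_mul_monomialFun {p : FormalSeries} {r : ℝ}
    (h : wnorm (polyWeight r) p ≠ ⊤) {x : R3} (hx : ‖x‖ ≤ r) :
    Summable fun α => |coeff α p * monomialFun α x| := by
  have hr : 0 ≤ r := (norm_nonneg x).trans hx
  refine Summable.of_nonneg_of_le (fun _ => abs_nonneg _) (fun α => ?_)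
    ((wnorm_polyWeight_ne_top_iff hr).mp h)
  rw [abs_mul]
  gcongr
  exact abs_monomialFun_le α hx

theorem IsConvergent.eventually_summable {p : FormalSeries} (h : IsConvergent p) :
    ∀ᶠ x in 𝓝 (0 : R3), Summable fun α => |coeff α p * monomialFun α x| := by
  obtain ⟨r, hr, hp⟩ := h
  filter_upwards [Metric.closedBall_mem_nhds (0 : R3) hr] with x hx
  exact summable_abs_coeff_mul_monomialFun hp (by simpa using hx)

section algebra

variable {p q : FormalSeries}

theorem IsConvergent.add (hp : IsConvergent p) (hq : IsConvergent q) : IsConvergent (p + q) := by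
  obtain ⟨r, hr, hp, hq⟩ := ((eventually_mem_nhdsWithin (a := (0 : ℝ)) (s := Set.Ioi 0)).and
    (hp.eventually_polyWeight.and hq.eventually_polyWeight)).exists
  exact ⟨r, hr, ne_top_of_le_ne_top (ENNReal.add_ne_top.mpr ⟨hp, hq⟩) (wnorm_add_le p q)⟩

theorem polyWeight_add {r : ℝ} (hr : 0 ≤ r) (α β : Fin 3 →₀ ℕ) :
    polyWeight r (α + β) = polyWeight r α * polyWeight r β := by
  rw [polyWeight, polyWeight, polyWeight, ← ENNReal.ofReal_mul (by positivity)]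
  simp only [Finsupp.add_apply]
  congr 1
  ring

theorem IsConvergent.mul (hp : IsConvergent p) (hq : IsConvergent q) : IsConvergent (p * q) := by
  obtain ⟨r, hr, hp, hq⟩ := ((eventually_mem_nhdsWithin (a := (0 : ℝ)) (s := Set.Ioi 0)).and
    (hp.eventually_polyWeight.and hq.eventually_polyWeight)).exists
  exact ⟨r, hr, ne_top_of_le_ne_top (ENNReal.mul_ne_top hp hq)
    (wnorm_mul_le (fun α β => (polyWeight_add (le_of_lt hr) α β).le) p q)⟩

theorem IsConvergent.neg (hp : IsConvergent p) : IsConvergent (-p) := by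
  obtain ⟨r, hr, hp⟩ := hp
  exact ⟨r, hr, by rwa [wnorm_neg]⟩

theorem isConvergent_zero : IsConvergent 0 := ⟨1, one_pos, by simp⟩

theorem IsConvergent.pderiv (hp : IsConvergent p) (i : Fin 3) :
    IsConvergent (MvPowerSeries.pderiv ℝ i p) := by
  obtain ⟨r, hr, hp⟩ := hp
  -- Halving the radius pays for the factor from differentiation, as `α i + 1 ≤ 2 ^ |α|`.
  refine ⟨r / 2, by positivity, ne_top_of_le_ne_top
    (ENNReal.mul_ne_top (a := ENNReal.ofReal r⁻¹) ENNReal.ofReal_ne_top hp) ?_⟩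
  refine (wnorm_pderiv_le (w₂ := fun α => ENNReal.ofReal r⁻¹ * polyWeight r α)
    (fun α => ?_) p).trans (wnorm_mono (fun _ => le_rfl) p)
  rw [polyWeight, polyWeight, ← ENNReal.ofReal_natCast, ← ENNReal.ofReal_mul (by positivity),
    ← ENNReal.ofReal_mul (by positivity)]
  refine ENNReal.ofReal_le_ofReal ?_
  have hdeg : (α + Finsupp.single i 1 : Fin 3 →₀ ℕ) 0 + ((α + Finsupp.single i 1 : Fin 3 →₀ ℕ) 1 +
      (α + Finsupp.single i 1 : Fin 3 →₀ ℕ) 2) = α 0 + (α 1 + α 2) + 1 := by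
    fin_cases i <;> simp <;> ring
  have hle : α i + 1 ≤ 2 ^ (α 0 + (α 1 + α 2)) := by
    refine le_trans ?_ (Nat.lt_two_pow_self (n := α 0 + (α 1 + α 2)))
    fin_cases i <;> simp <;> omega
  have hle' : ((α i + 1 : ℕ) : ℝ) ≤ 2 ^ (α 0 + (α 1 + α 2)) := by exact_mod_cast hle
  rw [hdeg]
  calc (r / 2) ^ (α 0 + (α 1 + α 2)) * (α i + 1 : ℕ)
      ≤ (r / 2) ^ (α 0 + (α 1 + α 2)) * 2 ^ (α 0 + (α 1 + α 2)) := by gcongr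
    _ = r ^ (α 0 + (α 1 + α 2)) := by rw [← mul_pow, div_mul_cancel₀ _ two_ne_zero]
    _ = r⁻¹ * r ^ (α 0 + (α 1 + α 2) + 1) := by rw [pow_succ]; field_simp

theorem seriesSum_add (hp : IsConvergent p) (hq : IsConvergent q) :
    seriesSum (p + q) =ᶠ[𝓝 0] fun x => seriesSum p x + seriesSum q x := by
  filter_upwards [hp.eventually_summable, hq.eventually_summable] with x h1 h2
  rw [seriesSum, seriesSum, seriesSum, ← h1.of_abs.tsum_add h2.of_abs]
  exact tsum_congr fun α => by rw [map_add, add_mul]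

theorem seriesSum_mul (hp : IsConvergent p) (hq : IsConvergent q) :
    seriesSum (p * q) =ᶠ[𝓝 0] fun x => seriesSum p x * seriesSum q x := by
  filter_upwards [hp.eventually_summable, hq.eventually_summable] with x h1 h2
  have h12 := summable_mul_of_summable_norm (f := fun α => coeff α p * monomialFun α x)
    (g := fun α => coeff α q * monomialFun α x) h1 h2
  have h3 := Summable.tsum_mul_tsum_eq_tsum_sum_antidiagonal h1.of_abs h2.of_abs h12
  refine Eq.trans ?_ h3.symm
  refine tsum_congr fun α => ?_
  rw [coeff_mul, Finset.sum_mul]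
  refine Finset.sum_congr rfl fun y hy => ?_
  rw [← mem_antidiagonal.mp hy, monomialFun_add]
  ring

theorem seriesSum_one (x : R3) : seriesSum 1 x = 1 := by
  rw [seriesSum, tsum_eq_single 0 fun α hα => by simp [coeff_one, hα]]
  simp

theorem seriesSum_zero (x : R3) : seriesSum 0 x = 0 := by simp [seriesSum]

theorem monomialFun_apply_zero {α : Fin 3 →₀ ℕ} (hα : α ≠ 0) : monomialFun α 0 = 0 := by
  have : α 0 ≠ 0 ∨ α 1 ≠ 0 ∨ α 2 ≠ 0 := by
    by_contra! h
    exact hα (Finsupp.ext fun i => by fin_cases i <;> simp [h])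
  rcases this with h | h | h <;> simp [monomialFun, h]

theorem seriesSum_apply_zero (p : FormalSeries) : seriesSum p 0 = coeff 0 p := by
  rw [seriesSum, tsum_eq_single 0 fun α hα => by simp [monomialFun_apply_zero hα]]
  simp

end algebra

/-! ### Analyticity of the sum -/

section analytic

/-- A word in three letters with given numbers of occurrences. -/
def sortedWord (n : ℕ) (α : Fin 3 →₀ ℕ) (i : Fin n) : Fin 3 :=
  if (i : ℕ) < α 0 then 0 else if (i : ℕ) < α 0 + α 1 then 1 else 2

theorem prod_sortedWord {n : ℕ} {α : Fin 3 →₀ ℕ} (h : α 0 + (α 1 + α 2) = n) (x : R3) :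
    ∏ i, x (sortedWord n α i) = monomialFun α x := by
  subst h
  simp only [sortedWord]
  rw [Fin.prod_univ_eq_prod_range
      (fun i => x (if i < α 0 then 0 else if i < α 0 + α 1 then 1 else 2)),
    prod_range_add, prod_range_add, monomialFun]
  congr 1
  · rw [Finset.prod_congr rfl fun i hi => by rw [if_pos (mem_range.mp hi)], prod_const, card_range]
  congr 1
  · rw [Finset.prod_congr rfl fun i hi => by
      rw [if_neg (by omega), if_pos (by have := mem_range.mp hi; omega)], prod_const, card_range]
  · rw [Finset.prod_congr rfl fun i hi => by
      rw [if_neg (by omega), if_neg (by omega)], prod_const, card_range]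

/-- The monomial `x ^ α` as a multilinear map. -/
def monomialMultilinear (n : ℕ) (α : Fin 3 →₀ ℕ) :
    ContinuousMultilinearMap ℝ (fun _ : Fin n => R3) ℝ :=
  (ContinuousMultilinearMap.mkPiAlgebra ℝ (Fin n) ℝ).compContinuousLinearMap
    fun i => ContinuousLinearMap.proj (sortedWord n α i)

theorem monomialMultilinear_apply {n : ℕ} {α : Fin 3 →₀ ℕ} (h : α 0 + (α 1 + α 2) = n) (x : R3) :
    (monomialMultilinear n α fun _ => x) = monomialFun α x := by
  simp [monomialMultilinear, prod_sortedWord h]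

theorem norm_monomialMultilinear_le (n : ℕ) (α : Fin 3 →₀ ℕ) : ‖monomialMultilinear n α‖ ≤ 1 := by
  refine ContinuousMultilinearMap.opNorm_le_bound zero_le_one fun m => ?_
  simp only [monomialMultilinear, ContinuousMultilinearMap.compContinuousLinearMap_apply,
    ContinuousMultilinearMap.mkPiAlgebra_apply, ContinuousLinearMap.proj_apply, one_mul]
  rw [norm_prod]
  exact Finset.prod_le_prod (fun _ _ => norm_nonneg _) fun i _ => norm_le_pi_norm (m i) _

/-- Absolute convergence permits grouping the monomials by degree. The resulting multilinear maps
need not be symmetric, because only their values on the diagonal enter. -/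
theorem analyticAt_seriesSum {p : FormalSeries} (hp : IsConvergent p) :
    AnalyticAt ℝ (seriesSum p) 0 := by
  obtain ⟨r, hr, h⟩ := hp
  have hs := (wnorm_polyWeight_ne_top_iff hr.le).mp h
  let deg : (Fin 3 →₀ ℕ) → ℕ := fun α => α 0 + (α 1 + α 2)
  let P : FormalMultilinearSeries ℝ R3 ℝ := fun n =>
    ∑' α : {α // deg α = n}, coeff α.1 p • monomialMultilinear n α.1
  have hbd : ∀ n (α : {α // deg α = n}),
      ‖coeff α.1 p • monomialMultilinear n α.1‖ * r ^ n ≤ |coeff α.1 p| * r ^ deg α.1 := by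
    intro n α
    rw [norm_smul, α.2, Real.norm_eq_abs]
    gcongr
    exact mul_le_of_le_one_right (abs_nonneg _) (norm_monomialMultilinear_le n _)
  have hsub : ∀ n, Summable fun α : {α // deg α = n} => |coeff α.1 p| * r ^ deg α.1 :=
    fun n => hs.subtype _
  have hsn : ∀ n, Summable fun α : {α // deg α = n} =>
      ‖coeff α.1 p • monomialMultilinear n α.1‖ := fun n => by
    have := Summable.of_nonneg_of_le (fun _ => by positivity) (hbd n) (hsub n)
    rwa [summable_mul_right_iff (by positivity)] at this
  refine HasFPowerSeriesAt.analyticAt (p := P) ⟨ENNReal.ofReal r, ?_, by simpa using hr, ?_⟩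
  · refine P.le_radius_of_bound (∑' α, |coeff α p| * r ^ deg α) fun n => ?_
    rw [Real.coe_toNNReal _ hr.le]
    calc ‖P n‖ * r ^ n
        ≤ (∑' α : {α // deg α = n}, ‖coeff α.1 p • monomialMultilinear n α.1‖) * r ^ n := by
          gcongr
          exact norm_tsum_le_tsum_norm (hsn n)
      _ = ∑' α : {α // deg α = n}, ‖coeff α.1 p • monomialMultilinear n α.1‖ * r ^ n :=
          tsum_mul_right.symm
      _ ≤ ∑' α : {α // deg α = n}, |coeff α.1 p| * r ^ deg α.1 :=
          Summable.tsum_le_tsum (hbd n) ((hsn n).mul_right _) (hsub n)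
      _ ≤ _ := hs.tsum_subtype_le _ {α | deg α = n} (fun α => by positivity)
  · intro y hy
    rw [zero_add]
    have hy' : ‖y‖ ≤ r := by
      simp only [Metric.mem_eball, edist_zero_right] at hy
      rw [← ofReal_norm, ENNReal.ofReal_lt_ofReal_iff hr] at hy
      exact hy.le
    have hsum := (summable_abs_coeff_mul_monomialFun h hy').of_abs
    have h1 : HasSum ((fun α => coeff α p * monomialFun α y) ∘ Equiv.sigmaFiberEquiv deg)
        (seriesSum p y) := (Equiv.hasSum_iff _).mpr hsum.hasSum
    refine h1.sigma fun n => ?_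
    have h2 := ContinuousMultilinearMap.hasSum_eval (hsn n).of_norm.hasSum fun _ => y
    refine h2.congr_fun ?_
    intro α
    simp [monomialMultilinear_apply α.2]

end analytic

/-! ### Termwise differentiation -/

theorem hasDerivAt_monomialFun (α : Fin 3 →₀ ℕ) (x : R3) (i : Fin 3) (t : ℝ) :
    HasDerivAt (fun t => monomialFun α (x + t • Pi.single i 1))
      (α i * monomialFun (α - Finsupp.single i 1) (x + t • Pi.single i 1)) t := by
  have h : ∀ j, HasDerivAt (fun t : ℝ => (x + t • (Pi.single i 1 : R3)) j)
      ((Pi.single i 1 : R3) j) t := fun j => by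
    simpa using ((hasDerivAt_id t).mul_const ((Pi.single i 1 : R3) j)).const_add (x j)
  have h3 := ((h 0).pow (α 0)).mul (((h 1).pow (α 1)).mul ((h 2).pow (α 2)))
  refine h3.congr_deriv ?_
  fin_cases i <;> simp [monomialFun] <;> ring

/-- The majorant for termwise differentiation. Where `α i = 0`, the truncated subtraction is
harmless because the factor `α i` kills the term. -/
theorem summable_abs_coeff_mul_shift {p : FormalSeries} {i : Fin 3} {r : ℝ}
    (h : wnorm (polyWeight r) (pderiv ℝ i p) ≠ ⊤) (hr : 0 ≤ r) :
    Summable fun α : Fin 3 →₀ ℕ => |coeff α p| *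
      (α i * r ^ ((α - Finsupp.single i 1 : Fin 3 →₀ ℕ) 0 +
      ((α - Finsupp.single i 1 : Fin 3 →₀ ℕ) 1 + (α - Finsupp.single i 1 : Fin 3 →₀ ℕ) 2))) := by
  have hinj : Function.Injective fun α : Fin 3 →₀ ℕ => α + Finsupp.single i 1 :=
    add_left_injective _
  refine (hinj.summable_iff fun α hα => ?_).mp ?_
  · have : α i = 0 := by
      by_contra h0
      refine hα ⟨α - Finsupp.single i 1, tsub_add_cancel_of_le ?_⟩
      rw [Finsupp.single_le_iff]
      omega
    simp [this]
  · refine ((wnorm_polyWeight_ne_top_iff hr).mp h).congr fun α => ?_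
    have h0 : (0 : ℝ) ≤ α i + 1 := by positivity
    simp only [Function.comp, add_tsub_cancel_right, coeff_pderiv, abs_mul, abs_of_nonneg h0]
    simp
    ring

theorem seriesSum_pderiv_eq {p : FormalSeries} {i : Fin 3} (x : R3) :
    seriesSum (pderiv ℝ i p) x =
      ∑' α, coeff α p * (α i * monomialFun (α - Finsupp.single i 1) x) := by
  have hinj : Function.Injective fun α : Fin 3 →₀ ℕ => α + Finsupp.single i 1 :=
    add_left_injective _
  have hs : Function.support (fun α => coeff α p * (α i * monomialFun (α - Finsupp.single i 1) x)) ⊆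
      Set.range fun α : Fin 3 →₀ ℕ => α + Finsupp.single i 1 := by
    intro α hα
    by_cases h0 : α i = 0
    · simp [h0] at hα
    · refine ⟨α - Finsupp.single i 1, tsub_add_cancel_of_le ?_⟩
      rw [Finsupp.single_le_iff]
      omega
  rw [← hinj.tsum_eq hs, seriesSum]
  refine tsum_congr fun α => ?_
  simp [coeff_pderiv]
  ring

theorem seriesSum_pderiv {p : FormalSeries} (hp : IsConvergent p) (i : Fin 3) :
    seriesSum (pderiv ℝ i p) =ᶠ[𝓝 0] fun x => fderiv ℝ (seriesSum p) x (Pi.single i 1) := by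
  obtain ⟨r, hr, h1, h2⟩ := ((eventually_mem_nhdsWithin (a := (0 : ℝ)) (s := Set.Ioi 0)).and
    (hp.eventually_polyWeight.and (hp.pderiv i).eventually_polyWeight)).exists
  replace hr : 0 < r := hr
  filter_upwards [(analyticAt_seriesSum hp).eventually_analyticAt,
    -- With `x` and the line parameter `t` both below `r / 2`, the line `x + t e_i` stays in the
    -- polydisc of radius `r`.
    Metric.ball_mem_nhds (0 : R3) (half_pos hr)] with x hx hxr
  have hxr' : ‖x‖ < r / 2 := by simpa using hxr
  have hnorm : ∀ t ∈ Metric.ball (0 : ℝ) (r / 2), ‖x + t • (Pi.single i 1 : R3)‖ ≤ r := by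
    intro t ht
    have ht' : ‖t‖ < r / 2 := by simpa using ht
    refine (norm_add_le _ _).trans ?_
    rw [norm_smul, Pi.norm_single, norm_one, mul_one]
    linarith
  have hd : HasDerivAt (fun t : ℝ => seriesSum p (x + t • (Pi.single i 1 : R3)))
      (seriesSum (MvPowerSeries.pderiv ℝ i p) (x + (0 : ℝ) • (Pi.single i 1 : R3))) 0 := by
    rw [seriesSum_pderiv_eq]
    refine hasDerivAt_tsum_of_isPreconnected (summable_abs_coeff_mul_shift h2 hr.le)
      Metric.isOpen_ball (convex_ball (0 : ℝ) (r / 2)).isPreconnected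
      (fun α t _ => (hasDerivAt_monomialFun α x i t).const_mul _) (fun α t ht => ?_)
      (Metric.mem_ball_self (half_pos hr)) (y₀ := 0) ?_ (Metric.mem_ball_self (half_pos hr))
    · rw [Real.norm_eq_abs, abs_mul, abs_mul, Nat.abs_cast]
      gcongr
      exact abs_monomialFun_le _ (hnorm t ht)
    · exact (summable_abs_coeff_mul_monomialFun h1
        (hnorm 0 (Metric.mem_ball_self (half_pos hr)))).of_abs
  have hl : HasDerivAt (fun t : ℝ => x + t • (Pi.single i 1 : R3)) (Pi.single i 1) 0 := by
    simpa using ((hasDerivAt_id (0 : ℝ)).smul_const (Pi.single i 1 : R3)).const_add x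
  have hf : HasFDerivAt (seriesSum p) (fderiv ℝ (seriesSum p) x)
      (x + (0 : ℝ) • (Pi.single i 1 : R3)) := by
    simpa using hx.differentiableAt.hasFDerivAt
  have := hd.unique (HasFDerivAt.comp_hasDerivAt
    (f := fun t : ℝ => x + t • (Pi.single i 1 : R3)) 0 hf hl)
  simpa using this

/-! ### Analytic germs as convergent power series -/

/-- The subring of convergent power series. -/
def convergentSubring : Subring FormalSeries where
  carrier := {p | IsConvergent p}
  mul_mem' := IsConvergent.mul
  one_mem' := isConvergent_one
  add_mem' := IsConvergent.add
  zero_mem' := isConvergent_zero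
  neg_mem' := IsConvergent.neg

/-- The germ of the sum of a convergent power series. -/
def sumGerm : convergentSubring →+* AnalyticGerm R3 where
  toFun p := ⟨(seriesSum p.1 : R3 → ℝ), seriesSum p.1, analyticAt_seriesSum p.2, rfl⟩
  map_one' := Subtype.ext <| Germ.coe_eq.mpr <| Eventually.of_forall seriesSum_one
  map_zero' := Subtype.ext <| Germ.coe_eq.mpr <| Eventually.of_forall seriesSum_zero
  map_add' p q := Subtype.ext <| Germ.coe_eq.mpr <| seriesSum_add p.2 q.2
  map_mul' p q := Subtype.ext <| Germ.coe_eq.mpr <| seriesSum_mul p.2 q.2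

theorem val0_sumGerm (p : convergentSubring) : (sumGerm p).val0 = coeff 0 p.1 :=
  seriesSum_apply_zero p.1

theorem partialD_sumGerm (i : Fin 3) (p : convergentSubring) :
    (sumGerm p).partialD i = sumGerm ⟨pderiv ℝ i p.1, IsConvergent.pderiv p.2 i⟩ :=
  Subtype.ext <| Germ.coe_eq.mpr <| (seriesSum_pderiv p.2 i).symm

/-- Coefficients of a convergent series vanish if its germ belongs to a set of germs that vanish at
`0`, stable under the relevant partial derivatives. -/
theorem coeff_eq_zero_of_sumGerm_mem {Z : Set (AnalyticGerm R3)} {I : Set (Fin 3)}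
    (h0 : ∀ φ ∈ Z, φ.val0 = 0) (hd : ∀ φ ∈ Z, ∀ i ∈ I, φ.partialD i ∈ Z) (n : ℕ) :
    ∀ (α : Fin 3 →₀ ℕ), α.degree = n → (∀ i, i ∉ I → α i = 0) →
      ∀ p : convergentSubring, sumGerm p ∈ Z → coeff α p.1 = 0 := by
  induction n with
  | zero =>
    intro α hα _ p hp
    rw [Finsupp.degree_eq_zero_iff] at hα
    rw [hα, ← val0_sumGerm]
    exact h0 _ hp
  | succ n ih =>
    intro α hα hI p hp
    obtain ⟨i, hi⟩ : ∃ i, α i ≠ 0 := by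
      by_contra! h
      have : α = 0 := Finsupp.ext h
      simp [this] at hα
    have hiI : i ∈ I := by
      by_contra h
      exact hi (hI i h)
    have hle : Finsupp.single i 1 ≤ α := by
      rw [Finsupp.single_le_iff]
      omega
    have hα' : α - Finsupp.single i 1 + Finsupp.single i 1 = α := tsub_add_cancel_of_le hle
    have hdeg : (α - Finsupp.single i 1).degree = n := by
      have := congrArg Finsupp.degree hα'
      rw [map_add, Finsupp.degree_single, hα] at this
      omega
    have := ih (α - Finsupp.single i 1) hdeg (fun j hj => by simp [hI j hj])
      ⟨pderiv ℝ i p.1, IsConvergent.pderiv p.2 i⟩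
      (by rw [← partialD_sumGerm]; exact hd _ hp i hiI)
    rw [coeff_pderiv, hα'] at this
    exact (mul_eq_zero.mp this).resolve_right (by positivity)

theorem partialD_zero (i : Fin 3) : (0 : AnalyticGerm R3).partialD i = 0 := by
  rw [← map_zero sumGerm, partialD_sumGerm]
  congr 1
  exact Subtype.ext (map_zero _)

/-- The coefficients are recovered, up to nonzero factors, by iterated partial derivatives at `0`,
and these vanish for the zero germ. -/
theorem sumGerm_injective : Function.Injective sumGerm := by
  refine (injective_iff_map_eq_zero _).mpr fun p hp => Subtype.ext ?_
  ext α
  refine coeff_eq_zero_of_sumGerm_mem (Z := {0}) (I := Set.univ) ?_ ?_ _ α rfl (by simp) p hp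
  · rintro φ rfl
    rfl
  · rintro φ rfl i _
    exact partialD_zero i

/-! ### Monomial expansion of an analytic function -/

/-- The number of occurrences of each letter in a word. -/
def wordContent {n : ℕ} (v : Fin n → Fin 3) : Fin 3 →₀ ℕ := ∑ i, Finsupp.single (v i) 1

theorem monomialFun_single (j : Fin 3) (x : R3) : monomialFun (Finsupp.single j 1) x = x j := by
  fin_cases j <;> simp [monomialFun]

theorem monomialFun_wordContent {n : ℕ} (v : Fin n → Fin 3) (x : R3) :
    monomialFun (wordContent v) x = ∏ i, x (v i) := by
  let φ : Multiplicative (Fin 3 →₀ ℕ) →* ℝ :=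
    { toFun := fun α => monomialFun α.toAdd x
      map_one' := monomialFun_zero x
      map_mul' := fun α β => monomialFun_add _ _ x }
  have h : φ (Multiplicative.ofAdd (wordContent v)) =
      ∏ i, φ (Multiplicative.ofAdd (Finsupp.single (v i) 1)) := by
    rw [wordContent, ofAdd_sum, map_prod]
  exact h.trans (Finset.prod_congr rfl fun i _ => monomialFun_single _ x)

theorem degree_wordContent {n : ℕ} (v : Fin n → Fin 3) :
    wordContent v 0 + (wordContent v 1 + wordContent v 2) = n := by
  have h : (wordContent v).degree = n := by
    rw [wordContent, map_sum]
    simp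
  rw [Finsupp.degree_eq_sum, Fin.sum_univ_three] at h
  omega

/-- An absolutely convergent sum over words may be regrouped according to the exponent of the
monomial. -/
theorem exists_seriesSum_eq_tsum {W : Type*} (c : W → Fin 3 →₀ ℕ) (a : W → ℝ) {s : ℝ} (hs : 0 < s)
    (h : Summable fun w => |a w| * s ^ (c w 0 + (c w 1 + c w 2))) :
    ∃ p : FormalSeries, wnorm (polyWeight s) p ≠ ⊤ ∧
      ∀ x : R3, ‖x‖ ≤ s → seriesSum p x = ∑' w, a w * monomialFun (c w) x := by
  have h' : Summable fun x : Σ α, {w // c w = α} =>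
      |a x.2.1| * s ^ (x.1 0 + (x.1 1 + x.1 2)) := by
    refine ((Equiv.sigmaFiberEquiv c).summable_iff.mpr h).congr fun x => ?_
    obtain ⟨_, w, rfl⟩ := x
    rfl
  have hα := (summable_sigma_of_nonneg fun w => by positivity).mp h'
  have haα : ∀ α, Summable fun w : {w // c w = α} => |a w.1| := fun α =>
    (summable_mul_right_iff (a := s ^ (α 0 + (α 1 + α 2))) (pow_pos hs _).ne').mp (hα.1 α)
  let p : FormalSeries := fun α => ∑' w : {w // c w = α}, a w.1
  have hp : ∀ α, coeff α p = ∑' w : {w // c w = α}, a w.1 := fun α => rfl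
  clear_value p
  refine ⟨p, (wnorm_polyWeight_ne_top_iff hs.le).mpr ?_, fun x hx => ?_⟩
  · refine Summable.of_nonneg_of_le (fun α => by positivity) (fun α => ?_) hα.2
    refine le_of_le_of_eq ?_
      (tsum_mul_right (f := fun w : {w // c w = α} => |a w.1|) (a := s ^ (α 0 + (α 1 + α 2)))).symm
    rw [hp]
    gcongr
    have := norm_tsum_le_tsum_norm (haα α).of_abs.norm
    simpa only [Real.norm_eq_abs] using this
  · have hsx : Summable fun w => a w * monomialFun (c w) x := by
      refine Summable.of_norm_bounded h fun w => ?_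
      rw [norm_mul, Real.norm_eq_abs, Real.norm_eq_abs]
      gcongr
      exact abs_monomialFun_le _ hx
    have hsx' : Summable fun y : Σ α, {w // c w = α} => a y.2.1 * monomialFun (c y.2.1) x :=
      (Equiv.sigmaFiberEquiv c).summable_iff.mpr hsx
    have e : ∑' w, a w * monomialFun (c w) x =
        ∑' y : Σ α, {w // c w = α}, a y.2.1 * monomialFun (c y.2.1) x :=
      ((Equiv.sigmaFiberEquiv c).tsum_eq fun w => a w * monomialFun (c w) x).symm
    rw [e, hsx'.tsum_sigma' fun α => hsx'.sigma_factor α, seriesSum]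
    refine tsum_congr fun α => ?_
    rw [hp, ← tsum_mul_right]
    refine tsum_congr fun w => ?_
    rw [w.2]

theorem exists_seriesSum_eq {f : R3 → ℝ} (hf : AnalyticAt ℝ f 0) :
    ∃ p : FormalSeries, IsConvergent p ∧ seriesSum p =ᶠ[𝓝 0] f := by
  obtain ⟨P, R, hP⟩ := hf
  obtain ⟨r, hr0, hrR⟩ := ENNReal.lt_iff_exists_nnreal_btwn.mp hP.r_pos
  have hr : 0 < (r : ℝ) := by exact_mod_cast hr0
  have hsum := P.summable_norm_mul_pow (hrR.trans_le hP.r_le)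
  have ha : ∀ n (v : Fin n → Fin 3), |P n fun i => Pi.single (v i) 1| ≤ ‖P n‖ := fun n v => by
    refine ((P n).le_opNorm _).trans_eq ?_
    simp [Pi.norm_single]
  -- Expanding `P n` on the standard basis produces `3 ^ n` words of length `n`; the radius `r / 3`
  -- compensates for their number.
  have hW : Summable fun w : Σ n : ℕ, Fin n → Fin 3 =>
      |P w.1 fun i => Pi.single (w.2 i) 1| * (r / 3 : ℝ) ^ w.1 := by
    refine (summable_sigma_of_nonneg fun w => by positivity).mpr
      ⟨fun n => (hasSum_fintype _).summable, ?_⟩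
    refine Summable.of_nonneg_of_le (fun n => tsum_nonneg fun v => by positivity) (fun n => ?_) hsum
    rw [tsum_fintype]
    calc ∑ v : Fin n → Fin 3, |P n fun i => Pi.single (v i) 1| * (r / 3 : ℝ) ^ n
        ≤ ∑ v : Fin n → Fin 3, ‖P n‖ * (r / 3 : ℝ) ^ n := by
          gcongr with v
          exact ha n v
      _ = ‖P n‖ * r ^ n := by
          simp only [sum_const, card_univ, Fintype.card_pi, Fintype.card_fin, prod_const,
            nsmul_eq_mul, Nat.cast_pow, Nat.cast_ofNat, div_pow]
          field_simp
  have hs : (0 : ℝ) < r / 3 := by positivity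
  obtain ⟨p, hp, hpx⟩ := exists_seriesSum_eq_tsum
    (fun w : Σ n : ℕ, Fin n → Fin 3 => wordContent w.2)
    (fun w => P w.1 fun i => Pi.single (w.2 i) 1) hs
    (by simpa only [degree_wordContent] using hW)
  refine ⟨p, ⟨r / 3, hs, hp⟩, ?_⟩
  filter_upwards [Metric.ball_mem_nhds (0 : R3) hs] with x hx
  have hx' : ‖x‖ < r / 3 := by simpa using hx
  have hxR : x ∈ Metric.eball (0 : R3) R := by
    rw [Metric.mem_eball, edist_zero_right]
    refine lt_trans ?_ hrR
    rw [← ofReal_norm, ENNReal.ofReal_lt_coe_iff (norm_nonneg _)]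
    linarith
  have hsx : Summable fun w : Σ n : ℕ, Fin n → Fin 3 =>
      (P w.1 fun i => Pi.single (w.2 i) 1) * monomialFun (wordContent w.2) x := by
    refine Summable.of_norm_bounded hW fun w => ?_
    rw [norm_mul, Real.norm_eq_abs, Real.norm_eq_abs]
    gcongr
    exact (abs_monomialFun_le _ hx'.le).trans_eq (by rw [degree_wordContent])
  have hf := hP.hasSum hxR
  rw [zero_add] at hf
  rw [hpx x hx'.le, hsx.tsum_sigma' fun n => (hasSum_fintype _).summable, ← hf.tsum_eq]
  refine tsum_congr fun n => ?_
  rw [tsum_fintype]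
  have hx : x = ∑ j, x j • (Pi.single j 1 : R3) := by
    ext k
    simp [Finset.sum_apply, Pi.single_apply]
  have hmap := (P n).toMultilinearMap.map_sum fun (_ : Fin n) j => x j • (Pi.single j 1 : R3)
  rw [← hx] at hmap
  refine Eq.trans ?_ hmap.symm
  refine Finset.sum_congr rfl fun v _ => ?_
  rw [(P n).toMultilinearMap.map_smul_univ (fun i => x (v i)), monomialFun_wordContent, smul_eq_mul,
    mul_comm]
  rfl

theorem sumGerm_surjective : Function.Surjective sumGerm := by
  rintro ⟨_, f, hf, rfl⟩
  obtain ⟨p, hp, h⟩ := exists_seriesSum_eq hf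
  exact ⟨⟨p, hp⟩, Subtype.ext (Germ.coe_eq.mpr h)⟩

/-- The Taylor series of an analytic germ. -/
def toSeries : AnalyticGerm R3 →+* FormalSeries :=
  convergentSubring.subtype.comp
    (RingEquiv.ofBijective sumGerm ⟨sumGerm_injective, sumGerm_surjective⟩).symm.toRingHom

theorem toSeries_sumGerm (p : convergentSubring) : toSeries (sumGerm p) = p.1 :=
  congrArg Subtype.val
    ((RingEquiv.ofBijective sumGerm ⟨sumGerm_injective, sumGerm_surjective⟩).symm_apply_apply p)

theorem toSeries_injective : Function.Injective toSeries :=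
  Subtype.val_injective.comp (RingEquiv.injective _)

theorem isConvergent_toSeries (φ : AnalyticGerm R3) : IsConvergent (toSeries φ) := by
  obtain ⟨p, rfl⟩ := sumGerm_surjective φ
  rw [toSeries_sumGerm]
  exact p.2

theorem toSeries_partialD (i : Fin 3) (φ : AnalyticGerm R3) :
    toSeries (φ.partialD i) = pderiv ℝ i (toSeries φ) := by
  obtain ⟨p, rfl⟩ := sumGerm_surjective φ
  rw [partialD_sumGerm, toSeries_sumGerm, toSeries_sumGerm]

/-! ### Calculus of analytic germs and restriction to the hypersurface -/

namespace AnalyticGerm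

/-- This rule and the following ones are transported from the derivations of formal power series,
since `toSeries` is injective and commutes with partial derivatives. -/
theorem partialD_add (i : Fin 3) (φ ψ : AnalyticGerm R3) :
    (φ + ψ).partialD i = φ.partialD i + ψ.partialD i :=
  toSeries_injective <| by simp only [toSeries_partialD, map_add]

theorem partialD_sub (i : Fin 3) (φ ψ : AnalyticGerm R3) :
    (φ - ψ).partialD i = φ.partialD i - ψ.partialD i :=
  toSeries_injective <| by simp only [toSeries_partialD, map_sub]

theorem partialD_neg (i : Fin 3) (φ : AnalyticGerm R3) : (-φ).partialD i = -φ.partialD i :=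
  toSeries_injective <| by simp only [toSeries_partialD, map_neg]

theorem partialD_mul (i : Fin 3) (φ ψ : AnalyticGerm R3) :
    (φ * ψ).partialD i = φ * ψ.partialD i + ψ * φ.partialD i :=
  toSeries_injective <| by
    simp only [toSeries_partialD, map_add, map_mul, Derivation.leibniz, smul_eq_mul]

theorem partialD_one (i : Fin 3) : (1 : AnalyticGerm R3).partialD i = 0 :=
  toSeries_injective <| by
    simp only [toSeries_partialD, map_one, map_zero, Derivation.map_one_eq_zero]

theorem partialD_ofNat (i : Fin 3) (n : ℕ) [n.AtLeastTwo] :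
    (ofNat(n) : AnalyticGerm R3).partialD i = 0 :=
  toSeries_injective <| by
    rw [toSeries_partialD, map_ofNat, map_zero]
    exact Derivation.map_natCast _ n

theorem val0_mul {E : Type*} [NormedAddCommGroup E] [NormedSpace ℝ E] (φ ψ : AnalyticGerm E) :
    (φ * ψ).val0 = φ.val0 * ψ.val0 := by
  obtain ⟨_, f, _, rfl⟩ := φ
  obtain ⟨_, g, _, rfl⟩ := ψ
  rfl

/-- The value at the base point as a ring homomorphism. -/
def val0Hom (E : Type*) [NormedAddCommGroup E] [NormedSpace ℝ E] : AnalyticGerm E →+* ℝ where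
  toFun := val0
  map_one' := rfl
  map_zero' := rfl
  map_mul' := val0_mul
  map_add' φ ψ := by
    obtain ⟨_, f, _, rfl⟩ := φ
    obtain ⟨_, g, _, rfl⟩ := ψ
    rfl

@[simp]
theorem val0Hom_apply {E : Type*} [NormedAddCommGroup E] [NormedSpace ℝ E] (φ : AnalyticGerm E) :
    val0Hom E φ = φ.val0 := rfl

/-- Restriction to the hypersurface `x¹ = 0` as a ring homomorphism. -/
def restrictHom : AnalyticGerm R3 →+* AnalyticGerm hyp where
  toFun := restrict
  map_one' := rfl
  map_zero' := rfl
  map_mul' φ ψ := by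
    obtain ⟨_, f, _, rfl⟩ := φ
    obtain ⟨_, g, _, rfl⟩ := ψ
    rfl
  map_add' φ ψ := by
    obtain ⟨_, f, _, rfl⟩ := φ
    obtain ⟨_, g, _, rfl⟩ := ψ
    rfl

@[simp]
theorem restrictHom_apply (φ : AnalyticGerm R3) : restrictHom φ = φ.restrict := rfl

theorem restrict_sub_eq_zero {φ ψ : AnalyticGerm R3} (h : φ.restrict = ψ.restrict) :
    (φ - ψ).restrict = 0 := by
  rw [← restrictHom_apply, map_sub]
  exact sub_eq_zero.mpr h

/-- A germ that does not vanish at the base point is invertible. -/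
theorem isUnit_of_val0_ne_zero {E : Type*} [NormedAddCommGroup E] [NormedSpace ℝ E]
    {φ : AnalyticGerm E} (h : φ.val0 ≠ 0) : IsUnit φ := by
  obtain ⟨_, f, hf, rfl⟩ := φ
  replace h : f 0 ≠ 0 := h
  refine IsUnit.of_mul_eq_one ⟨(f⁻¹ : E → ℝ), f⁻¹, hf.inv h, rfl⟩ ?_
  refine Subtype.ext <| Germ.coe_eq.mpr ?_
  filter_upwards [hf.continuousAt.eventually_ne h] with x hx
  exact mul_inv_cancel₀ hx

/-- The exponential of an analytic germ. -/
def exp (φ : AnalyticGerm R3) : AnalyticGerm R3 :=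
  ⟨(φ : Germ (𝓝 (0 : R3)) ℝ).map Real.exp, by
    obtain ⟨_, f, hf, rfl⟩ := φ
    exact ⟨fun x => Real.exp (f x), hf.rexp, rfl⟩⟩

theorem isUnit_exp (φ : AnalyticGerm R3) : IsUnit φ.exp := by
  refine isUnit_of_val0_ne_zero ?_
  obtain ⟨_, f, hf, rfl⟩ := φ
  exact (Real.exp_pos (f 0)).ne'

theorem partialD_exp (i : Fin 3) (φ : AnalyticGerm R3) :
    φ.exp.partialD i = φ.exp * φ.partialD i := by
  obtain ⟨_, f, hf, rfl⟩ := φ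
  refine Subtype.ext <| Germ.coe_eq.mpr ?_
  filter_upwards [hf.eventually_analyticAt] with x hx
  have := (hx.differentiableAt.hasFDerivAt.exp).fderiv
  change fderiv ℝ (fun x => Real.exp (f x)) x _ = Real.exp (f x) * _
  rw [this]
  rfl

/-- The projection along `x¹`. -/
def hypProj : R3 →L[ℝ] hyp :=
  LinearMap.toContinuousLinearMap
    (LinearMap.codRestrict hyp
      (LinearMap.id - (LinearMap.single ℝ (fun _ : Fin 3 => ℝ) 0).comp (LinearMap.proj 0))
      fun x => by simp [hyp])

theorem hypProj_coe (y : hyp) : hypProj (y : R3) = y := by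
  have : (y : R3) 0 = 0 := y.2
  ext i
  change (y : R3) i - (Pi.single 0 ((y : R3) 0) : R3) i = (y : R3) i
  simp [this]

/-- The extension of a germ on the hypersurface `x¹ = 0` that does not depend on `x¹`. -/
def extend (φ : AnalyticGerm hyp) : AnalyticGerm R3 :=
  ⟨(φ : Germ (𝓝 (0 : hyp)) ℝ).compTendsto hypProj (hypProj.continuous.tendsto' 0 0 (map_zero _)), by
    obtain ⟨_, f, hf, rfl⟩ := φ
    refine ⟨fun x => f (hypProj x), ?_, rfl⟩
    have h0 : AnalyticAt ℝ f (hypProj 0) := by rwa [map_zero]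
    exact h0.comp (hypProj.analyticAt 0)⟩

theorem restrict_extend (φ : AnalyticGerm hyp) : φ.extend.restrict = φ := by
  obtain ⟨_, f, hf, rfl⟩ := φ
  refine Subtype.ext <| Germ.coe_eq.mpr <| Eventually.of_forall fun y => ?_
  exact congrArg f (hypProj_coe y)

/-- The direction `e_i` is tangent to `x¹ = 0`, so near `0` the function vanishes along short
segments in this direction through points of the hypersurface. -/
theorem restrict_partialD_eq_zero {φ : AnalyticGerm R3} (h : φ.restrict = 0) {i : Fin 3}
    (hi : i ≠ 0) : (φ.partialD i).restrict = 0 := by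
  obtain ⟨_, f, hf, rfl⟩ := φ
  have h1 : ∀ᶠ y : hyp in 𝓝 0, f y = 0 := Germ.coe_eq.mp (congrArg Subtype.val h)
  have h2 : ∀ᶠ y : hyp in 𝓝 0, AnalyticAt ℝ f y :=
    (continuous_subtype_val.tendsto (0 : hyp)).eventually hf.eventually_analyticAt
  refine Subtype.ext <| Germ.coe_eq.mpr ?_
  filter_upwards [h1.eventually_nhds, h2] with y hy hfy
  have hmem : (Pi.single i 1 : R3) ∈ hyp := by
    simp [hyp, Ne.symm hi]
  let e : hyp := ⟨Pi.single i 1, hmem⟩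
  have hc : Tendsto (fun t : ℝ => y + t • e) (𝓝 0) (𝓝 y) := by
    refine Continuous.tendsto' (by fun_prop) _ _ ?_
    simp
  have hl : HasDerivAt (fun t : ℝ => (y : R3) + t • (Pi.single i 1 : R3)) (Pi.single i 1) 0 := by
    simpa using ((hasDerivAt_id (0 : ℝ)).smul_const (Pi.single i 1 : R3)).const_add (y : R3)
  have hf' : HasFDerivAt f (fderiv ℝ f y) ((y : R3) + (0 : ℝ) • (Pi.single i 1 : R3)) := by
    simpa using hfy.differentiableAt.hasFDerivAt
  have h3 := HasFDerivAt.comp_hasDerivAt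
    (f := fun t : ℝ => (y : R3) + t • (Pi.single i 1 : R3)) 0 hf' hl
  have h4 : (f ∘ fun t : ℝ => (y : R3) + t • (Pi.single i 1 : R3)) =ᶠ[𝓝 0] fun _ => 0 :=
    hc.eventually hy
  exact h3.unique ((hasDerivAt_const (0 : ℝ) (0 : ℝ)).congr_of_eventuallyEq h4)

/-- Vanishing on the hypersurface is inherited by tangential derivatives, which forces all
coefficients with `α 0 = 0` to vanish. This turns the initial condition into a divisibility. -/
theorem restrict_eq_zero_iff {φ : AnalyticGerm R3} :
    φ.restrict = 0 ↔ (X 0 : FormalSeries) ∣ toSeries φ := by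
  obtain ⟨p, rfl⟩ := sumGerm_surjective φ
  rw [toSeries_sumGerm, X_dvd_iff]
  constructor
  · intro h α hα
    refine coeff_eq_zero_of_sumGerm_mem (Z := {φ | φ.restrict = 0}) (I := {i | i ≠ 0}) ?_ ?_ _ α rfl
      ?_ p h
    · intro φ hφ
      rw [← val0_restrict, hφ]
      rfl
    · intro φ hφ i hi
      exact restrict_partialD_eq_zero hφ hi
    · intro i hi
      rw [not_not.mp hi, hα]
  · intro h
    refine Subtype.ext <| Germ.coe_eq.mpr <| Eventually.of_forall fun y => ?_
    have hy : (y : R3) 0 = 0 := y.2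
    change seriesSum p.1 y = 0
    rw [seriesSum]
    refine (tsum_congr fun α => ?_).trans tsum_zero
    by_cases hα : α 0 = 0
    · rw [h α hα, zero_mul]
    · simp [monomialFun, hy, hα]

/-! ### The Cauchy problem for germs -/

/-- Uniqueness in the Cauchy problem, for differences of solutions: germs that vanish on `x¹ = 0`
and whose `x¹`-derivatives are linear combinations of the germs and of their tangential derivatives
vanish. -/
theorem eq_zero_of_partialD_mem_span {ι : Type*} {d : ι → AnalyticGerm R3}
    (h0 : ∀ i, (d i).restrict = 0) {J : Ideal (AnalyticGerm R3)}
    (hJ : J = Ideal.span {φ | ∃ j, φ = d j ∨ φ = (d j).partialD 1 ∨ φ = (d j).partialD 2})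
    (hd : ∀ i, (d i).partialD 0 ∈ J) (i : ι) : d i = 0 := by
  have key : ∀ n i, (X 0 : FormalSeries) ^ n ∣ toSeries (d i) := by
    intro n
    induction n with
    | zero => simp
    | succ n ih =>
      -- Divisibility by `(x¹) ^ n` passes from the `d j` to their tangential derivatives, hence to
      -- all of `J` and in particular to `∂₁ d`. Together with vanishing on `x¹ = 0`, this gives
      -- divisibility of `d` by `(x¹) ^ (n + 1)`.
      have hle : J ≤ (Ideal.span {(X 0 : FormalSeries) ^ n}).comap toSeries := by
        rw [hJ, Ideal.span_le]
        rintro φ ⟨j, rfl | rfl | rfl⟩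
        · exact Ideal.mem_span_singleton.mpr (ih j)
        · refine Ideal.mem_span_singleton.mpr ?_
          rw [toSeries_partialD]
          exact X_pow_dvd_pderiv (by decide) (ih j)
        · refine Ideal.mem_span_singleton.mpr ?_
          rw [toSeries_partialD]
          exact X_pow_dvd_pderiv (by decide) (ih j)
      intro i
      have h1 := Ideal.mem_span_singleton.mp (hle (hd i))
      rw [toSeries_partialD, X_pow_dvd_iff] at h1
      have h2 := X_dvd_iff.mp (restrict_eq_zero_iff.mp (h0 i))
      rw [X_pow_dvd_iff]
      intro α hα
      by_cases hα0 : α 0 = 0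
      · exact h2 α hα0
      · have hle : Finsupp.single 0 1 ≤ α := by
          rw [Finsupp.single_le_iff]
          omega
        have h3 := h1 (α - Finsupp.single 0 1) (by simp; omega)
        rw [coeff_pderiv, tsub_add_cancel_of_le hle] at h3
        exact (mul_eq_zero.mp h3).resolve_right (by positivity)
  refine toSeries_injective ?_
  rw [map_zero]
  exact eq_zero_of_forall_X_pow_dvd fun n => key n i

/-- Existence in the Cauchy problem `∂₁ U = F(U)`, `U = U₀` on `x¹ = 0`. -/
theorem exists_partialD_eq {ι : Type*} [Finite ι] {F : ι → (ι → FormalSeries) → FormalSeries}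
    (hF : ∀ i, IsTame weightD (F i)) (U₀ : ι → AnalyticGerm hyp) :
    ∃ U : ι → AnalyticGerm R3, (∀ i, (U i).restrict = U₀ i) ∧
      ∀ i, toSeries ((U i).partialD 0) = F i fun j => toSeries (U j) := by
  -- The extension does not depend on `x¹`, so the subtracted derivative is zero; keeping it makes
  -- it cancel in the final identity without a proof of this fact.
  have hG : ∀ i, IsTame weightD fun u => F i u - toSeries ((U₀ i).extend.partialD 0) :=
    fun i => (hF i).sub (isTame_const (isConvergent_toSeries _)).weightD
  obtain ⟨u, hu⟩ := exists_isConvergent_eq_add_primitive hG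
    fun i => isConvergent_toSeries (U₀ i).extend
  have hT : ∀ i, toSeries (sumGerm ⟨u i, (hu i).1⟩) = u i := fun i => toSeries_sumGerm _
  refine ⟨fun i => sumGerm ⟨u i, (hu i).1⟩, fun i => ?_, fun i => ?_⟩
  · rw [← sub_eq_zero]
    conv_lhs => rw [← restrict_extend (U₀ i)]
    rw [← restrictHom_apply, ← restrictHom_apply, ← map_sub, restrictHom_apply,
      restrict_eq_zero_iff, map_sub, hT, (hu i).2, add_sub_cancel_left]
    exact X_dvd_primitive _
  · simp only [toSeries_partialD, hT]
    conv_lhs => rw [(hu i).2]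
    rw [map_add, pderiv_primitive, toSeries_partialD]
    ring

end AnalyticGerm

theorem isTame_one {ι : Type*} : IsTame weight fun _ : ι → FormalSeries => 1 :=
  isTame_const isConvergent_one

theorem isTame_ofNat {ι : Type*} (n : ℕ) [n.AtLeastTwo] :
    IsTame weight fun _ : ι → FormalSeries => ofNat(n) :=
  isTame_const (ofNat_mem convergentSubring n)

theorem isTame_toSeries {ι : Type*} (φ : AnalyticGerm R3) :
    IsTame weight fun _ : ι → FormalSeries => toSeries φ :=
  isTame_const (isConvergent_toSeries φ)

namespace AnalyticGerm

/-- The Cauchy problem for a pair of linear equations without tangential derivatives. -/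
theorem exists_linear_pair (p q r p' q' r' : AnalyticGerm R3) (x₀ y₀ : AnalyticGerm hyp) :
    ∃ x y : AnalyticGerm R3, x.restrict = x₀ ∧ y.restrict = y₀ ∧
      x.partialD 0 = p + q * x + r * y ∧ y.partialD 0 = p' + q' * x + r' * y := by
  obtain ⟨U, hU, hD⟩ := exists_partialD_eq (F := ![
      fun u : Fin 2 → FormalSeries => toSeries p + toSeries q * u 0 + toSeries r * u 1,
      fun u : Fin 2 → FormalSeries => toSeries p' + toSeries q' * u 0 + toSeries r' * u 1])
    (by
      have h : ∀ p q r : AnalyticGerm R3, IsTame weightD fun u : Fin 2 → FormalSeries =>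
          toSeries p + toSeries q * u 0 + toSeries r * u 1 := fun p q r =>
        (((isTame_toSeries p).add ((isTame_toSeries q).mul (isTame_apply 0))).add
          ((isTame_toSeries r).mul (isTame_apply 1))).weightD
      intro i
      fin_cases i
      · exact h p q r
      · exact h p' q' r') ![x₀, y₀]
  refine ⟨U 0, U 1, hU 0, hU 1, toSeries_injective ?_, toSeries_injective ?_⟩
  · simp only [map_add, map_mul]
    exact hD 0
  · simp only [map_add, map_mul]
    exact hD 1

theorem eq_of_linear_pair {p q r p' q' r' x y x' y' : AnalyticGerm R3}
    (hx : x.restrict = x'.restrict) (hy : y.restrict = y'.restrict)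
    (h1 : x.partialD 0 = p + q * x + r * y) (h2 : y.partialD 0 = p' + q' * x + r' * y)
    (h1' : x'.partialD 0 = p + q * x' + r * y') (h2' : y'.partialD 0 = p' + q' * x' + r' * y') :
    x = x' ∧ y = y' := by
  let d : Fin 2 → AnalyticGerm R3 := ![x - x', y - y']
  have h0 : ∀ i, (d i).restrict = 0 := by
    intro i
    fin_cases i
    · exact restrict_sub_eq_zero hx
    · exact restrict_sub_eq_zero hy
  have hd : ∀ i, d i = 0 := by
    refine eq_zero_of_partialD_mem_span h0 rfl fun i => ?_
    have m0 := Ideal.subset_span (α := AnalyticGerm R3)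
      (show d 0 ∈ {φ | ∃ j, φ = d j ∨ φ = (d j).partialD 1 ∨ φ = (d j).partialD 2} from
        ⟨0, Or.inl rfl⟩)
    have m1 := Ideal.subset_span (α := AnalyticGerm R3)
      (show d 1 ∈ {φ | ∃ j, φ = d j ∨ φ = (d j).partialD 1 ∨ φ = (d j).partialD 2} from
        ⟨1, Or.inl rfl⟩)
    fin_cases i
    · convert Ideal.add_mem _ (Ideal.mul_mem_left _ q m0) (Ideal.mul_mem_left _ r m1) using 1
      change (x - x').partialD 0 = q * (x - x') + r * (y - y')
      rw [partialD_sub, h1, h1']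
      ring
    · convert Ideal.add_mem _ (Ideal.mul_mem_left _ q' m0) (Ideal.mul_mem_left _ r' m1) using 1
      change (y - y').partialD 0 = q' * (x - x') + r' * (y - y')
      rw [partialD_sub, h2, h2']
      ring
  exact ⟨sub_eq_zero.mp (hd 0), sub_eq_zero.mp (hd 1)⟩

end AnalyticGerm

/-! ### Vector fields and brackets -/

namespace VF

theorem app_add (X : VF) (f g : AnalyticGerm R3) : X.app (f + g) = X.app f + X.app g := by
  simp only [app, AnalyticGerm.partialD_add, mul_add, sum_add_distrib]

theorem app_neg (X : VF) (f : AnalyticGerm R3) : X.app (-f) = -X.app f := by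
  simp only [app, AnalyticGerm.partialD_neg, mul_neg, sum_neg_distrib]

theorem app_mul (X : VF) (f g : AnalyticGerm R3) : X.app (f * g) = f * X.app g + g * X.app f := by
  simp only [app, AnalyticGerm.partialD_mul, mul_sum, ← sum_add_distrib]
  exact sum_congr rfl fun j _ => by ring

theorem app_one (X : VF) : X.app 1 = 0 := by
  simp [app, AnalyticGerm.partialD_one]

theorem app_ofNat (X : VF) (n : ℕ) [n.AtLeastTwo] : X.app ofNat(n) = 0 := by
  simp only [app, AnalyticGerm.partialD_ofNat, mul_zero, sum_const_zero]

theorem app_exp (X : VF) (f : AnalyticGerm R3) : X.app f.exp = f.exp * X.app f := by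
  simp only [app, AnalyticGerm.partialD_exp, mul_sum]
  exact sum_congr rfl fun j _ => by ring

theorem app_single (f : AnalyticGerm R3) : app (Pi.single 0 1) f = f.partialD 0 := by
  simp [app, Fin.sum_univ_three]

theorem bracket_self (X : VF) : bracket X X = 0 := by
  funext q
  exact sub_self _

theorem bracket_swap (X Y : VF) : bracket Y X = -bracket X Y := by
  funext q
  exact (neg_sub _ _).symm

theorem bracket_single (X : VF) (q : Fin 3) :
    bracket (Pi.single 0 1) X q = (X q).partialD 0 := by
  have h : ∀ q j, ((Pi.single 0 1 : VF) q).partialD j = 0 := by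
    intro q j
    by_cases hq : q = 0
    · subst hq
      simp [AnalyticGerm.partialD_one]
    · simp [hq, partialD_zero]
  rw [bracket, app_single]
  simp [app, h]

end VF

/-! ### The symbol and Cramer's rule -/

/-- Up to a factor, the determinant of the symbol of the reduced system in the direction `x¹`. -/
def symbolDet {R : Type*} [CommRing R] (u : R) : R :=
  4 * u ^ 2 * ((1 + u) ^ 2 * (1 + u ^ 2) + u ^ 2)

/-- The derivative of `symbolDet`. -/
def symbolDetDeriv {R : Type*} [CommRing R] (u : R) : R :=
  4 * (2 * u * ((1 + u) ^ 2 * (1 + u ^ 2) + u ^ 2) +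
    u ^ 2 * (2 * (1 + u) * (1 + u ^ 2) + (1 + u) ^ 2 * (2 * u) + 2 * u))

/-- For `u > 0` the polynomial is positive term by term; here the sign condition on `u` makes the
hypersurface noncharacteristic. -/
theorem symbolDet_isUnit {E : Type*} [NormedAddCommGroup E] [NormedSpace ℝ E] {u : AnalyticGerm E}
    (hu : 0 < u.val0) : IsUnit (symbolDet u) := by
  refine AnalyticGerm.isUnit_of_val0_ne_zero ?_
  rw [← AnalyticGerm.val0Hom_apply, symbolDet]
  simp only [map_mul, map_add, map_pow, map_one, map_ofNat, AnalyticGerm.val0Hom_apply]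
  positivity

theorem partialD_symbolDet (i : Fin 3) (u : AnalyticGerm R3) :
    (symbolDet u).partialD i = symbolDetDeriv u * u.partialD i := by
  simp only [symbolDet, symbolDetDeriv, pow_two, AnalyticGerm.partialD_mul,
    AnalyticGerm.partialD_add, AnalyticGerm.partialD_ofNat, AnalyticGerm.partialD_one]
  ring

section cramer

variable {R : Type*} [CommRing R]

/-- The numerators in Cramer's rule for the symbol of the reduced system. -/
def cramer₁ (u x y z : R) : R :=
  2 * (1 + u) * (1 + u ^ 3) * x + (2 * (u ^ 2 - 1) * (1 + u) + 2 * u ^ 3) * y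
    + (2 * u ^ 2 - 2 * u ^ 2 * (u ^ 2 - 1) * (1 + u)) * z

/-- The numerators in Cramer's rule for the symbol of the reduced system. -/
def cramer₂ (u x y z : R) : R :=
  2 * u * (1 + u) * (1 - u ^ 3) * x + (-(2 * u * (1 + u) ^ 3) - 2 * u ^ 4) * y
    + (2 * u ^ 3 * (1 + u) ^ 3 + 2 * u ^ 3) * z

/-- The numerators in Cramer's rule for the symbol of the reduced system. -/
def cramer₃ (u x y z : R) : R :=
  2 * u ^ 2 * x + (u ^ 2 * (u ^ 2 - 1) - u ^ 2 * (1 + u) ^ 2) * y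
    + (-(u * (1 + u) ^ 2) - u * (u ^ 2 - 1)) * z

section map

variable {S : Type*} [CommRing S] (f : R →+* S)

theorem map_cramer₁ (u x y z : R) : f (cramer₁ u x y z) = cramer₁ (f u) (f x) (f y) (f z) := by
  simp only [cramer₁, map_add, map_sub, map_mul, map_pow, map_one, map_ofNat]

theorem map_cramer₂ (u x y z : R) : f (cramer₂ u x y z) = cramer₂ (f u) (f x) (f y) (f z) := by
  simp only [cramer₂, map_add, map_sub, map_neg, map_mul, map_pow, map_one, map_ofNat]

theorem map_cramer₃ (u x y z : R) : f (cramer₃ u x y z) = cramer₃ (f u) (f x) (f y) (f z) := by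
  simp only [cramer₃, map_add, map_sub, map_neg, map_mul, map_pow, map_one, map_ofNat]

theorem map_symbolDet (u : R) : f (symbolDet u) = symbolDet (f u) := by
  simp only [symbolDet, map_add, map_mul, map_pow, map_one, map_ofNat]

theorem map_symbolDetDeriv (u : R) : f (symbolDetDeriv u) = symbolDetDeriv (f u) := by
  simp only [symbolDetDeriv, map_add, map_mul, map_pow, map_one, map_ofNat]

end map

/-- The symbol matrix times its adjugate; it verifies the equations for the solution constructed in
the existence proof. -/
theorem cramer_apply (u x y z : R) :
    u * (1 + u) ^ 2 * cramer₁ u x y z + (u ^ 2 - 1) * cramer₂ u x y z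
        + 2 * u ^ 2 * cramer₃ u x y z = symbolDet u * x ∧
      u * cramer₁ u x y z - cramer₂ u x y z - 2 * u ^ 2 * (1 + u) * cramer₃ u x y z
        = symbolDet u * y ∧
      u ^ 2 * cramer₁ u x y z + u * cramer₂ u x y z - 2 * (u + 1) * cramer₃ u x y z
        = symbolDet u * z := by
  simp only [cramer₁, cramer₂, cramer₃, symbolDet]
  refine ⟨by ring, by ring, by ring⟩

/-- The adjugate times the symbol matrix; it shows in the uniqueness proof that the homogeneous
system has only the zero solution. -/
theorem cramer_of_apply (u x y z : R) :
    cramer₁ u (u * (1 + u) ^ 2 * x + (u ^ 2 - 1) * y + 2 * u ^ 2 * z)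
        (u * x - y - 2 * u ^ 2 * (1 + u) * z) (u ^ 2 * x + u * y - 2 * (u + 1) * z)
        = symbolDet u * x ∧
      cramer₂ u (u * (1 + u) ^ 2 * x + (u ^ 2 - 1) * y + 2 * u ^ 2 * z)
        (u * x - y - 2 * u ^ 2 * (1 + u) * z) (u ^ 2 * x + u * y - 2 * (u + 1) * z)
        = symbolDet u * y ∧
      cramer₃ u (u * (1 + u) ^ 2 * x + (u ^ 2 - 1) * y + 2 * u ^ 2 * z)
        (u * x - y - 2 * u ^ 2 * (1 + u) * z) (u ^ 2 * x + u * y - 2 * (u + 1) * z)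
        = symbolDet u * z := by
  simp only [cramer₁, cramer₂, cramer₃, symbolDet]
  refine ⟨by ring, by ring, by ring⟩

end cramer

/-! ### The reduced system -/

/-- The equations for `a`, `u`, `ξ`, in a form that is polynomial in `u`. -/
structure ReducedSystem (D : Fin 3 → VF) (c : Fin 3 → Fin 3 → Fin 3 → AnalyticGerm R3)
    (a u ξ : AnalyticGerm R3) : Prop where
  eq₁ : u * (1 + u) ^ 2 * (D 0).app a + (u ^ 2 - 1) * (D 0).app u + 2 * u ^ 2 * (D 0).app ξ =
    u ^ 2 * (2 + u) * c 0 1 1 + (2 * u ^ 2 + u) * c 0 2 2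
  eq₂ : u * (D 1).app a - (D 1).app u - 2 * u ^ 2 * (1 + u) * (D 1).app ξ =
    (u - u ^ 3) * c 1 2 2 - (2 * u ^ 2 + u ^ 3) * c 1 0 0
  eq₃ : u ^ 2 * (D 2).app a + u * (D 2).app u - 2 * (u + 1) * (D 2).app ξ =
    (u ^ 2 - 1) * c 2 1 1 - (2 * u + 1) * c 2 0 0

/-- The components of `g` in terms of `a`, `u` and `v = 1 / u`. -/
theorem two_mul_eq_of_eq_map₂ {g : Fin 3 → AnalyticGerm R3} {a u v : AnalyticGerm R3}
    (huv : u * v = 1)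
    (h : ∀ i, (g i : Germ (𝓝 (0 : R3)) ℝ) =
      Germ.map₂ (fun a u : ℝ => 1 / 2 * Real.exp a * ![1, -1 - u, -1 - 1 / u] i) a u) :
    2 * g 0 = a.exp ∧ 2 * g 1 = -(a.exp * (1 + u)) ∧ 2 * g 2 = -(a.exp * (1 + v)) := by
  obtain ⟨_, a, _, rfl⟩ := a
  obtain ⟨_, u, _, rfl⟩ := u
  obtain ⟨_, v, _, rfl⟩ := v
  have huv' : ∀ᶠ x in 𝓝 0, u x * v x = 1 := Germ.coe_eq.mp (congrArg Subtype.val huv)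
  have e : ∀ i, ((2 * g i : AnalyticGerm R3) : Germ (𝓝 (0 : R3)) ℝ) =
      ((fun x => 2 * (1 / 2 * Real.exp (a x) * ![1, -1 - u x, -1 - 1 / u x] i) : R3 → ℝ) :
        Germ (𝓝 (0 : R3)) ℝ) := fun i => by
    rw [Subring.coe_mul, h i]
    rfl
  refine ⟨Subtype.ext ((e 0).trans ?_), Subtype.ext ((e 1).trans ?_), Subtype.ext ((e 2).trans ?_)⟩
  · refine Germ.coe_eq.mpr (Eventually.of_forall fun x => ?_)
    simp
  · refine Germ.coe_eq.mpr (Eventually.of_forall fun x => ?_)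
    change _ = -(Real.exp (a x) * (1 + u x))
    simp
    ring
  · refine Germ.coe_eq.mpr ?_
    filter_upwards [huv'] with x hx
    change _ = -(Real.exp (a x) * (1 + v x))
    have : 1 / u x = v x := (eq_one_div_of_mul_eq_one_right hx).symm
    simp [← this]
    ring

theorem isUnit_two : IsUnit (2 : AnalyticGerm R3) := by
  refine AnalyticGerm.isUnit_of_val0_ne_zero ?_
  rw [← AnalyticGerm.val0Hom_apply, map_ofNat]
  norm_num

/-- The constraints on `g` are equivalent to the reduced system. -/
theorem constraint_iff_reducedSystem {D : Fin 3 → VF} {c : Fin 3 → Fin 3 → Fin 3 → AnalyticGerm R3}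
    {g : Fin 3 → AnalyticGerm R3} {a u ξ : AnalyticGerm R3} (hu : IsUnit u)
    (h : ∀ i, (g i : Germ (𝓝 (0 : R3)) ℝ) =
      Germ.map₂ (fun a u : ℝ => 1 / 2 * Real.exp a * ![1, -1 - u, -1 - 1 / u] i) a u) :
    (∀ i j k : Fin 3, j = i + 1 → k = i + 2 →
      0 = VF.app (D i) (g j + g k) + c i j j * (g i - g j) + c i k k * (g i - g k)
        - 2 * VF.app (D i) ξ * g i) ↔ ReducedSystem D c a u ξ := by
  obtain ⟨v, huv⟩ := hu.exists_right_inv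
  obtain ⟨h0, h1, h2⟩ := two_mul_eq_of_eq_map₂ huv h
  -- The derivative of `1 / u`, obtained by applying `X` to `u v = 1`.
  have hv : ∀ X : VF, u ^ 2 * X.app v = -X.app u := fun X => by
    have := congrArg X.app huv
    rw [VF.app_mul, VF.app_one] at this
    linear_combination u * this - X.app u * huv
  have d0 : ∀ X : VF, 2 * X.app (g 0) = a.exp * X.app a := fun X => by
    have := congrArg X.app h0
    simpa only [VF.app_mul, VF.app_ofNat, VF.app_exp, mul_zero, add_zero] using this
  have d1 : ∀ X : VF, 2 * X.app (g 1) = -(a.exp * X.app u + (1 + u) * (a.exp * X.app a)) :=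
    fun X => by
      have := congrArg X.app h1
      simpa only [VF.app_mul, VF.app_ofNat, VF.app_exp, VF.app_neg, VF.app_add, VF.app_one,
        mul_zero, add_zero, zero_add] using this
  have d2 : ∀ X : VF, 2 * X.app (g 2) = -(a.exp * X.app v + (1 + v) * (a.exp * X.app a)) :=
    fun X => by
      have := congrArg X.app h2
      simpa only [VF.app_mul, VF.app_ofNat, VF.app_exp, VF.app_neg, VF.app_add, VF.app_one,
        mul_zero, add_zero, zero_add] using this
  have hE := a.isUnit_exp
  -- Each constraint, multiplied by the unit `2 u²` (for `i = 1, 2`) or `2 u` (for `i = 3`), equals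
  -- `e^a` times the difference of the two sides of the corresponding reduced equation.
  have cancel : ∀ {w x y : AnalyticGerm R3}, IsUnit w → w * x = a.exp * y → (0 = x ↔ y = 0) :=
    fun hw hxy => by
      rw [eq_comm, ← hw.mul_right_eq_zero, hxy, hE.mul_right_eq_zero]
  have e0 := cancel (isUnit_two.mul (hu.pow 2))
    (x := VF.app (D 0) (g 1 + g 2) + c 0 1 1 * (g 0 - g 1) + c 0 2 2 * (g 0 - g 2)
        - 2 * VF.app (D 0) ξ * g 0)
    (y := u ^ 2 * (2 + u) * c 0 1 1 + (2 * u ^ 2 + u) * c 0 2 2 - (u * (1 + u) ^ 2 * (D 0).app a +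
      (u ^ 2 - 1) * (D 0).app u + 2 * u ^ 2 * (D 0).app ξ)) (by
    rw [VF.app_add]
    linear_combination u ^ 2 * d1 (D 0) + u ^ 2 * d2 (D 0) - a.exp * hv (D 0)
      + u ^ 2 * c 0 1 1 * (h0 - h1) + u ^ 2 * c 0 2 2 * (h0 - h2) - 2 * u ^ 2 * (D 0).app ξ * h0
      + (c 0 2 2 - (D 0).app a) * a.exp * u * huv)
  have e1 := cancel (isUnit_two.mul (hu.pow 2))
    (x := VF.app (D 1) (g 2 + g 0) + c 1 2 2 * (g 1 - g 2) + c 1 0 0 * (g 1 - g 0)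
        - 2 * VF.app (D 1) ξ * g 1)
    (y := (u - u ^ 3) * c 1 2 2 - (2 * u ^ 2 + u ^ 3) * c 1 0 0 - (u * (D 1).app a - (D 1).app u
      - 2 * u ^ 2 * (1 + u) * (D 1).app ξ)) (by
    rw [VF.app_add]
    linear_combination u ^ 2 * d2 (D 1) + u ^ 2 * d0 (D 1) - a.exp * hv (D 1)
      + u ^ 2 * c 1 2 2 * (h1 - h2) + u ^ 2 * c 1 0 0 * (h1 - h0) - 2 * u ^ 2 * (D 1).app ξ * h1
      + (c 1 2 2 - (D 1).app a) * a.exp * u * huv)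
  have e2 := cancel (isUnit_two.mul hu)
    (x := VF.app (D 2) (g 0 + g 1) + c 2 0 0 * (g 2 - g 0) + c 2 1 1 * (g 2 - g 1)
        - 2 * VF.app (D 2) ξ * g 2)
    (y := (u ^ 2 - 1) * c 2 1 1 - (2 * u + 1) * c 2 0 0 - (u ^ 2 * (D 2).app a + u * (D 2).app u
      - 2 * (u + 1) * (D 2).app ξ)) (by
    rw [VF.app_add]
    linear_combination u * d0 (D 2) + u * d1 (D 2)
      + u * c 2 0 0 * (h2 - h0) + u * c 2 1 1 * (h2 - h1) - 2 * u * (D 2).app ξ * h2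
      + (2 * (D 2).app ξ - c 2 0 0 - c 2 1 1) * a.exp * huv)
  constructor
  · intro H
    exact ⟨(sub_eq_zero.mp (e0.mp (H 0 1 2 rfl rfl))).symm,
      (sub_eq_zero.mp (e1.mp (H 1 2 0 rfl rfl))).symm,
      (sub_eq_zero.mp (e2.mp (H 2 0 1 rfl rfl))).symm⟩
  · rintro ⟨H0, H1, H2⟩ i j k rfl rfl
    fin_cases i
    · exact e0.mpr (sub_eq_zero.mpr H0.symm)
    · exact e1.mpr (sub_eq_zero.mpr H1.symm)
    · exact e2.mpr (sub_eq_zero.mpr H2.symm)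

/-! ### The reduced system in solved form and its tameness -/

section rhs

variable {R : Type*} [CommRing R]

/-- The part of `X(f)` that involves the tangential derivatives `d₁`, `d₂`. -/
def tangential (X : Fin 3 → R) (d₁ d₂ : R → R) (f : R) : R := X 1 * d₁ f + X 2 * d₂ f

/-- The right hand side of the first equation of the reduced system. -/
def reducedRHS₁ (c : Fin 3 → Fin 3 → Fin 3 → R) (u : Fin 4 → R) : R :=
  u 1 ^ 2 * (2 + u 1) * c 0 1 1 + (2 * u 1 ^ 2 + u 1) * c 0 2 2

/-- The second equation of the reduced system, solved for the derivatives in the direction `x¹`. -/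
def reducedRHS₂ (D : Fin 3 → Fin 3 → R) (c : Fin 3 → Fin 3 → Fin 3 → R) (e : R) (d₁ d₂ : R → R)
    (u : Fin 4 → R) : R :=
  e * ((u 1 - u 1 ^ 3) * c 1 2 2 - (2 * u 1 ^ 2 + u 1 ^ 3) * c 1 0 0
    - (u 1 * tangential (D 1) d₁ d₂ (u 0) - tangential (D 1) d₁ d₂ (u 1)
      - 2 * u 1 ^ 2 * (1 + u 1) * tangential (D 1) d₁ d₂ (u 2)))

/-- The third equation of the reduced system, solved for the derivatives in the direction `x¹`. -/
def reducedRHS₃ (D : Fin 3 → Fin 3 → R) (c : Fin 3 → Fin 3 → Fin 3 → R) (e : R) (d₁ d₂ : R → R)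
    (u : Fin 4 → R) : R :=
  e * ((u 1 ^ 2 - 1) * c 2 1 1 - (2 * u 1 + 1) * c 2 0 0
    - (u 1 ^ 2 * tangential (D 2) d₁ d₂ (u 0) + u 1 * tangential (D 2) d₁ d₂ (u 1)
      - 2 * (u 1 + 1) * tangential (D 2) d₁ d₂ (u 2)))

/-- The reduced system for `u 0 = a`, `u 1 = u`, `u 2 = ξ`, solved for the derivatives in the
direction `x¹`, with the auxiliary unknown `u 3 = 1 / symbolDet u`. -/
def reducedRHS (D : Fin 3 → Fin 3 → R) (c : Fin 3 → Fin 3 → Fin 3 → R) (e₁ e₂ : R) (d₁ d₂ : R → R)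
    (u : Fin 4 → R) : Fin 4 → R :=
  let x := reducedRHS₁ c u
  let y := reducedRHS₂ D c e₁ d₁ d₂ u
  let z := reducedRHS₃ D c e₂ d₁ d₂ u
  ![u 3 * cramer₁ (u 1) x y z, u 3 * cramer₂ (u 1) x y z, u 3 * cramer₃ (u 1) x y z,
    -(u 3 ^ 2 * symbolDetDeriv (u 1) * (u 3 * cramer₂ (u 1) x y z))]

end rhs

/-- The right-hand side is polynomial in the germs and their tangential derivatives, so it commutes
with Taylor expansion. For this reason the inverses are inputs: `e₁`, `e₂` are given germs and `u 3`
is an unknown. -/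
theorem toSeries_reducedRHS (D : Fin 3 → VF) (c : Fin 3 → Fin 3 → Fin 3 → AnalyticGerm R3)
    (e₁ e₂ : AnalyticGerm R3) (u : Fin 4 → AnalyticGerm R3) (i : Fin 4) :
    toSeries (reducedRHS D c e₁ e₂ (AnalyticGerm.partialD 1) (AnalyticGerm.partialD 2) u i) =
      reducedRHS (fun i j => toSeries (D i j)) (fun i j k => toSeries (c i j k)) (toSeries e₁)
        (toSeries e₂) (pderiv ℝ 1) (pderiv ℝ 2) (fun j => toSeries (u j)) i := by
  have h1 : toSeries (reducedRHS₁ c u) =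
      reducedRHS₁ (fun i j k => toSeries (c i j k)) (fun j => toSeries (u j)) := by
    simp only [reducedRHS₁, map_add, map_mul, map_pow, map_ofNat]
  have h2 : toSeries (reducedRHS₂ D c e₁ (AnalyticGerm.partialD 1) (AnalyticGerm.partialD 2) u) =
      reducedRHS₂ (fun i j => toSeries (D i j)) (fun i j k => toSeries (c i j k)) (toSeries e₁)
        (pderiv ℝ 1) (pderiv ℝ 2) (fun j => toSeries (u j)) := by
    simp only [reducedRHS₂, tangential, map_add, map_sub, map_mul, map_pow, map_ofNat, map_one,
      toSeries_partialD]
  have h3 : toSeries (reducedRHS₃ D c e₂ (AnalyticGerm.partialD 1) (AnalyticGerm.partialD 2) u) =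
      reducedRHS₃ (fun i j => toSeries (D i j)) (fun i j k => toSeries (c i j k)) (toSeries e₂)
        (pderiv ℝ 1) (pderiv ℝ 2) (fun j => toSeries (u j)) := by
    simp only [reducedRHS₃, tangential, map_add, map_sub, map_mul, map_pow, map_ofNat, map_one,
      toSeries_partialD]
  rw [reducedRHS, reducedRHS, ← h1, ← h2, ← h3]
  fin_cases i
  · exact (map_mul _ _ _).trans (congrArg _ (map_cramer₁ _ _ _ _ _))
  · exact (map_mul _ _ _).trans (congrArg _ (map_cramer₂ _ _ _ _ _))
  · exact (map_mul _ _ _).trans (congrArg _ (map_cramer₃ _ _ _ _ _))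
  · refine (map_neg _ _).trans (congrArg _ ?_)
    rw [map_mul, map_mul, map_pow, map_mul, map_cramer₂, map_symbolDetDeriv]

section tame

variable {ι : Type*} {U x y z : (ι → FormalSeries) → FormalSeries}

theorem isTame_cramer₁ (hU : IsTame weight U) (hx : IsTame weightD x) (hy : IsTame weightD y)
    (hz : IsTame weightD z) : IsTame weightD fun u => cramer₁ (U u) (x u) (y u) (z u) := by
  unfold cramer₁
  refine ((IsTame.mulD ?_ hx).add (IsTame.mulD ?_ hy)).add (IsTame.mulD ?_ hz) <;>
  repeat' first
    | exact hU | exact isTame_one | exact isTame_ofNat _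
    | apply IsTame.pow | apply IsTame.sub | apply IsTame.add | apply IsTame.mul

theorem isTame_cramer₂ (hU : IsTame weight U) (hx : IsTame weightD x) (hy : IsTame weightD y)
    (hz : IsTame weightD z) : IsTame weightD fun u => cramer₂ (U u) (x u) (y u) (z u) := by
  unfold cramer₂
  refine ((IsTame.mulD ?_ hx).add (IsTame.mulD ?_ hy)).add (IsTame.mulD ?_ hz) <;>
  repeat' first
    | exact hU | exact isTame_one | exact isTame_ofNat _
    | apply IsTame.neg | apply IsTame.pow | apply IsTame.sub | apply IsTame.add | apply IsTame.mul

theorem isTame_cramer₃ (hU : IsTame weight U) (hx : IsTame weightD x) (hy : IsTame weightD y)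
    (hz : IsTame weightD z) : IsTame weightD fun u => cramer₃ (U u) (x u) (y u) (z u) := by
  unfold cramer₃
  refine ((IsTame.mulD ?_ hx).add (IsTame.mulD ?_ hy)).add (IsTame.mulD ?_ hz) <;>
  repeat' first
    | exact hU | exact isTame_one | exact isTame_ofNat _
    | apply IsTame.neg | apply IsTame.pow | apply IsTame.sub | apply IsTame.add | apply IsTame.mul

theorem isTame_symbolDetDeriv (hU : IsTame weight U) :
    IsTame weight fun u => symbolDetDeriv (U u) := by
  unfold symbolDetDeriv
  repeat' first
    | exact hU | exact isTame_one | exact isTame_ofNat _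
    | apply IsTame.pow | apply IsTame.sub | apply IsTame.add | apply IsTame.mul

theorem isTame_tangential (X : VF) (i : ι) :
    IsTame weightD fun u : ι → FormalSeries =>
      tangential (fun j => toSeries (X j)) (pderiv ℝ 1) (pderiv ℝ 2) (u i) :=
  ((isTame_toSeries _).mulD (isTame_pderiv_apply i (by decide))).add
    ((isTame_toSeries _).mulD (isTame_pderiv_apply i (by decide)))

variable (D : Fin 3 → VF) (c : Fin 3 → Fin 3 → Fin 3 → AnalyticGerm R3) (e e' : AnalyticGerm R3)

theorem isTame_reducedRHS₁ :
    IsTame weightD (reducedRHS₁ fun i j k => toSeries (c i j k)) := by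
  unfold reducedRHS₁
  apply IsTame.weightD
  repeat' first
    | exact isTame_apply _ | exact isTame_toSeries _ | exact isTame_ofNat _
    | apply IsTame.pow | apply IsTame.add | apply IsTame.mul

theorem isTame_reducedRHS₂ :
    IsTame weightD (reducedRHS₂ (fun i j => toSeries (D i j)) (fun i j k => toSeries (c i j k))
      (toSeries e) (pderiv ℝ 1) (pderiv ℝ 2)) := by
  unfold reducedRHS₂
  refine (isTame_toSeries e).mulD (IsTame.sub (IsTame.weightD ?_)
    ((IsTame.sub (IsTame.mulD ?_ (isTame_tangential _ _)) (isTame_tangential _ _)).sub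
      (IsTame.mulD ?_ (isTame_tangential _ _)))) <;>
  repeat' first
    | exact isTame_apply _ | exact isTame_toSeries _ | exact isTame_ofNat _ | exact isTame_one
    | apply IsTame.pow | apply IsTame.sub | apply IsTame.add | apply IsTame.mul

theorem isTame_reducedRHS₃ :
    IsTame weightD (reducedRHS₃ (fun i j => toSeries (D i j)) (fun i j k => toSeries (c i j k))
      (toSeries e) (pderiv ℝ 1) (pderiv ℝ 2)) := by
  unfold reducedRHS₃
  refine (isTame_toSeries e).mulD (IsTame.sub (IsTame.weightD ?_)
    ((IsTame.add (IsTame.mulD ?_ (isTame_tangential _ _))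
      (IsTame.mulD ?_ (isTame_tangential _ _))).sub (IsTame.mulD ?_ (isTame_tangential _ _)))) <;>
  repeat' first
    | exact isTame_apply _ | exact isTame_toSeries _ | exact isTame_ofNat _ | exact isTame_one
    | apply IsTame.pow | apply IsTame.sub | apply IsTame.add | apply IsTame.mul

theorem isTame_reducedRHS (i : Fin 4) :
    IsTame weightD fun u => reducedRHS (fun i j => toSeries (D i j))
      (fun i j k => toSeries (c i j k)) (toSeries e) (toSeries e') (pderiv ℝ 1)
      (pderiv ℝ 2) u i := by
  have hx := isTame_reducedRHS₁ c
  have hy := isTame_reducedRHS₂ D c e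
  have hz := isTame_reducedRHS₃ D c e'
  have hu : IsTame weight fun u : Fin 4 → FormalSeries => u 1 := isTame_apply 1
  have hq : IsTame weight fun u : Fin 4 → FormalSeries => u 3 := isTame_apply 3
  fin_cases i
  · exact hq.mulD (isTame_cramer₁ hu hx hy hz)
  · exact hq.mulD (isTame_cramer₂ hu hx hy hz)
  · exact hq.mulD (isTame_cramer₃ hu hx hy hz)
  · exact (((hq.pow 2).mul (isTame_symbolDetDeriv hu)).mulD
      (hq.mulD (isTame_cramer₂ hu hx hy hz))).neg

end tame

/-! ### The Cauchy problem for the reduced system -/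

theorem VF.app_eq_add_tangential (X : VF) (f : AnalyticGerm R3) :
    X.app f = X 0 * f.partialD 0 +
      tangential X (AnalyticGerm.partialD 1) (AnalyticGerm.partialD 2) f := by
  rw [VF.app, Fin.sum_univ_three, tangential, add_assoc]

namespace ReducedSystem

variable {D : Fin 3 → VF} {c : Fin 3 → Fin 3 → Fin 3 → AnalyticGerm R3}

/-- The Cauchy problem for the reduced system has a solution. -/
theorem exists_of_restrict (hD : D 0 = Pi.single 0 1) (h₁ : IsUnit (D 1 0)) (h₂ : IsUnit (D 2 0))
    (a₀ u₀ ξ₀ : AnalyticGerm hyp) (hu₀ : 0 < u₀.val0) :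
    ∃ a u ξ : AnalyticGerm R3, a.restrict = a₀ ∧ u.restrict = u₀ ∧ ξ.restrict = ξ₀ ∧
      ReducedSystem D c a u ξ := by
  obtain ⟨e₁, he₁⟩ := h₁.exists_right_inv
  obtain ⟨e₂, he₂⟩ := h₂.exists_right_inv
  obtain ⟨q₀, hq₀⟩ := (symbolDet_isUnit hu₀).exists_right_inv
  obtain ⟨U, hU, hUD⟩ := AnalyticGerm.exists_partialD_eq (isTame_reducedRHS D c e₁ e₂)
    ![a₀, u₀, ξ₀, q₀]
  have hUD' : ∀ i, (U i).partialD 0 =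
      reducedRHS D c e₁ e₂ (AnalyticGerm.partialD 1) (AnalyticGerm.partialD 2) U i := fun i =>
    toSeries_injective ((hUD i).trans (toSeries_reducedRHS D c e₁ e₂ U i).symm)
  set x := reducedRHS₁ c U with hx
  set y := reducedRHS₂ D c e₁ (AnalyticGerm.partialD 1) (AnalyticGerm.partialD 2) U with hy
  set z := reducedRHS₃ D c e₂ (AnalyticGerm.partialD 1) (AnalyticGerm.partialD 2) U with hz
  have H0 : (U 0).partialD 0 = U 3 * cramer₁ (U 1) x y z := hUD' 0
  have H1 : (U 1).partialD 0 = U 3 * cramer₂ (U 1) x y z := hUD' 1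
  have H2 : (U 2).partialD 0 = U 3 * cramer₃ (U 1) x y z := hUD' 2
  have H3 : (U 3).partialD 0 = -(U 3 ^ 2 * symbolDetDeriv (U 1) * (U 3 * cramer₂ (U 1) x y z)) :=
    hUD' 3
  -- The auxiliary unknown really is the inverse determinant: `w = symbolDet u * q - 1` vanishes on
  -- `x¹ = 0` and satisfies the homogeneous linear equation `∂₁ w = -q * symbolDetDeriv u * ∂₁ u *
  -- w`, so uniqueness gives `w = 0`.
  have hq : symbolDet (U 1) * U 3 = 1 := by
    refine sub_eq_zero.mp (AnalyticGerm.eq_zero_of_partialD_mem_span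
      (d := fun _ : Unit => symbolDet (U 1) * U 3 - 1) (fun _ => ?_) rfl (fun _ => ?_) ())
    · refine AnalyticGerm.restrict_sub_eq_zero ?_
      rw [← AnalyticGerm.restrictHom_apply, ← AnalyticGerm.restrictHom_apply, map_mul, map_one,
        ← hq₀]
      rw [map_symbolDet, AnalyticGerm.restrictHom_apply, AnalyticGerm.restrictHom_apply, hU, hU]
      rfl
    · have hmem := Ideal.subset_span (α := AnalyticGerm R3)
        (show symbolDet (U 1) * U 3 - 1 ∈ {φ | ∃ j : Unit, φ = symbolDet (U 1) * U 3 - 1 ∨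
          φ = (symbolDet (U 1) * U 3 - 1).partialD 1 ∨
          φ = (symbolDet (U 1) * U 3 - 1).partialD 2} from ⟨(), Or.inl rfl⟩)
      convert Ideal.mul_mem_left _ (-(U 3 * symbolDetDeriv (U 1) * (U 1).partialD 0)) hmem using 1
      rw [AnalyticGerm.partialD_sub, AnalyticGerm.partialD_one, AnalyticGerm.partialD_mul,
        partialD_symbolDet, H3, ← H1]
      ring
  obtain ⟨C1, C2, C3⟩ := cramer_apply (U 1) x y z
  have E1 : U 1 * (1 + U 1) ^ 2 * (U 0).partialD 0 + (U 1 ^ 2 - 1) * (U 1).partialD 0 +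
      2 * U 1 ^ 2 * (U 2).partialD 0 = x := by
    rw [H0, H1, H2]
    linear_combination U 3 * C1 + x * hq
  have E2 : U 1 * (U 0).partialD 0 - (U 1).partialD 0 -
      2 * U 1 ^ 2 * (1 + U 1) * (U 2).partialD 0 = y := by
    rw [H0, H1, H2]
    linear_combination U 3 * C2 + y * hq
  have E3 : U 1 ^ 2 * (U 0).partialD 0 + U 1 * (U 1).partialD 0 -
      2 * (U 1 + 1) * (U 2).partialD 0 = z := by
    rw [H0, H1, H2]
    linear_combination U 3 * C3 + z * hq
  refine ⟨U 0, U 1, U 2, hU 0, hU 1, hU 2, ⟨?_, ?_, ?_⟩⟩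
  · rw [hD, VF.app_single, VF.app_single, VF.app_single, E1, hx, reducedRHS₁]
  · rw [VF.app_eq_add_tangential, VF.app_eq_add_tangential, VF.app_eq_add_tangential]
    rw [reducedRHS₂] at hy
    linear_combination D 1 0 * (E2.trans hy) + ((U 1 - U 1 ^ 3) * c 1 2 2 -
      (2 * U 1 ^ 2 + U 1 ^ 3) * c 1 0 0 - (U 1 * tangential (D 1) (AnalyticGerm.partialD 1)
        (AnalyticGerm.partialD 2) (U 0) - tangential (D 1) (AnalyticGerm.partialD 1)
        (AnalyticGerm.partialD 2) (U 1) - 2 * U 1 ^ 2 * (1 + U 1) * tangential (D 1)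
        (AnalyticGerm.partialD 1) (AnalyticGerm.partialD 2) (U 2))) * he₁
  · rw [VF.app_eq_add_tangential, VF.app_eq_add_tangential, VF.app_eq_add_tangential]
    rw [reducedRHS₃] at hz
    linear_combination D 2 0 * (E3.trans hz) + ((U 1 ^ 2 - 1) * c 2 1 1 -
      (2 * U 1 + 1) * c 2 0 0 - (U 1 ^ 2 * tangential (D 2) (AnalyticGerm.partialD 1)
        (AnalyticGerm.partialD 2) (U 0) + U 1 * tangential (D 2) (AnalyticGerm.partialD 1)
        (AnalyticGerm.partialD 2) (U 1) - 2 * (U 1 + 1) * tangential (D 2)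
        (AnalyticGerm.partialD 1) (AnalyticGerm.partialD 2) (U 2))) * he₂

/-- The Cauchy problem for the reduced system has at most one solution. -/
theorem eq_of_restrict (hD : D 0 = Pi.single 0 1) (h₁ : IsUnit (D 1 0)) (h₂ : IsUnit (D 2 0))
    {a u ξ a' u' ξ' : AnalyticGerm R3} (hu : 0 < u.val0) (H : ReducedSystem D c a u ξ)
    (H' : ReducedSystem D c a' u' ξ') (ha : a.restrict = a'.restrict)
    (huu : u.restrict = u'.restrict) (hξ : ξ.restrict = ξ'.restrict) :
    a = a' ∧ u = u' ∧ ξ = ξ' := by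
  let d : Fin 3 → AnalyticGerm R3 := ![a - a', u - u', ξ - ξ']
  let J := Ideal.span {φ | ∃ j, φ = d j ∨ φ = (d j).partialD 1 ∨ φ = (d j).partialD 2}
  -- Modulo `J` the two solutions and their tangential derivatives agree. Subtracting the nonlinear
  -- equations therefore leaves a homogeneous linear system for the `∂₁`-derivatives of the
  -- differences, whose determinant is a unit.
  let π := Ideal.Quotient.mk J
  have hd0 : ∀ j, π (d j) = 0 := fun j =>
    Ideal.Quotient.eq_zero_iff_mem.mpr (Ideal.subset_span ⟨j, Or.inl rfl⟩)
  have hd1 : ∀ j, π ((d j).partialD 1) = 0 := fun j =>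
    Ideal.Quotient.eq_zero_iff_mem.mpr (Ideal.subset_span ⟨j, Or.inr (Or.inl rfl)⟩)
  have hd2 : ∀ j, π ((d j).partialD 2) = 0 := fun j =>
    Ideal.Quotient.eq_zero_iff_mem.mpr (Ideal.subset_span ⟨j, Or.inr (Or.inr rfl)⟩)
  have hπu : π u' = π u := by
    have := hd0 1
    rw [show d 1 = u - u' from rfl, map_sub, sub_eq_zero] at this
    exact this.symm
  have happ : ∀ (X : VF) (f f' : AnalyticGerm R3), (∃ j, d j = f - f') →
      π (X.app f') = π (X.app f) - π (X 0) * π ((f - f').partialD 0) := by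
    rintro X f f' ⟨j, hj⟩
    have e1 := hd1 j
    have e2 := hd2 j
    rw [hj, AnalyticGerm.partialD_sub, map_sub, sub_eq_zero] at e1 e2
    simp only [VF.app, Fin.sum_univ_three, map_add, map_mul, AnalyticGerm.partialD_sub, map_sub, e1,
      e2]
    ring
  have hXa := fun X => happ X a a' ⟨0, rfl⟩
  have hXu := fun X => happ X u u' ⟨1, rfl⟩
  have hXξ := fun X => happ X ξ ξ' ⟨2, rfl⟩
  have E1 := congrArg π H.eq₁
  have E2 := congrArg π H.eq₂
  have E3 := congrArg π H.eq₃
  have E1' := congrArg π H'.eq₁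
  have E2' := congrArg π H'.eq₂
  have E3' := congrArg π H'.eq₃
  have hD0 : D 0 0 = 1 := by rw [hD, Pi.single_eq_same]
  simp only [map_add, map_sub, map_mul, map_pow, map_one, map_ofNat] at E1 E2 E3
  simp only [map_add, map_sub, map_mul, map_pow, map_one, map_ofNat, hπu, hXa, hXu, hXξ]
    at E1' E2' E3'
  set x := π ((a - a').partialD 0)
  set y := π ((u - u').partialD 0)
  set z := π ((ξ - ξ').partialD 0)
  rw [hD0, map_one] at E1'
  have F1 : π u * (1 + π u) ^ 2 * x + (π u ^ 2 - 1) * y + 2 * π u ^ 2 * z = 0 := by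
    linear_combination E1 - E1'
  have F2 : π u * x - y - 2 * π u ^ 2 * (1 + π u) * z = 0 := by
    refine (h₁.map π).mul_right_eq_zero.mp ?_
    linear_combination E2 - E2'
  have F3 : π u ^ 2 * x + π u * y - 2 * (π u + 1) * z = 0 := by
    refine (h₂.map π).mul_right_eq_zero.mp ?_
    linear_combination E3 - E3'
  have hdet : IsUnit (symbolDet (π u)) := by
    rw [← map_symbolDet]
    exact (symbolDet_isUnit hu).map π
  obtain ⟨G1, G2, G3⟩ := cramer_of_apply (π u) x y z
  rw [F1, F2, F3] at G1 G2 G3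
  simp only [cramer₁, cramer₂, cramer₃, mul_zero, add_zero] at G1 G2 G3
  have hx := hdet.mul_right_eq_zero.mp G1.symm
  have hy := hdet.mul_right_eq_zero.mp G2.symm
  have hz := hdet.mul_right_eq_zero.mp G3.symm
  have hd : ∀ i, d i = 0 := by
    refine AnalyticGerm.eq_zero_of_partialD_mem_span (fun i => ?_) (J := J) rfl fun i => ?_
    · fin_cases i
      · exact AnalyticGerm.restrict_sub_eq_zero ha
      · exact AnalyticGerm.restrict_sub_eq_zero huu
      · exact AnalyticGerm.restrict_sub_eq_zero hξ
    · refine Ideal.Quotient.eq_zero_iff_mem.mp ?_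
      fin_cases i
      · exact hx
      · exact hy
      · exact hz
  exact ⟨sub_eq_zero.mp (hd 0), sub_eq_zero.mp (hd 1), sub_eq_zero.mp (hd 2)⟩

end ReducedSystem

/-! ### Frames and structure coefficients -/

theorem isUnit_det_of_linearIndependent {D : Fin 3 → VF}
    (h : LinearIndependent ℝ fun i j => (D i j).val0) :
    IsUnit (Matrix.det (Matrix.of D)) := by
  refine AnalyticGerm.isUnit_of_val0_ne_zero ?_
  have h' : IsUnit (Matrix.of fun i j => (D i j).val0) :=
    Matrix.linearIndependent_rows_iff_isUnit.mp h
  rw [← AnalyticGerm.val0Hom_apply, RingHom.map_det]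
  exact ((Matrix.isUnit_iff_isUnit_det _).mp h').ne_zero

/-- With the frame as the rows of a matrix, the structure equation becomes a row vector times an
invertible matrix, which is how the `c_{jk}` are found and shown to be unique. -/
theorem sum_mul_eq_vecMul (D : Fin 3 → VF) (k : Fin 3 → AnalyticGerm R3) :
    (∑ i, fun q => k i * D i q) = Matrix.vecMul k (Matrix.of D) := by
  funext q
  simp [Matrix.vecMul, dotProduct, Finset.sum_apply]

/-- The Cauchy problem for the frame: `[∂₁, D₂]` and `[D₃, ∂₁]` are prescribed linear combinations
of the frame. -/
theorem exists_frame (c12 c31 : Fin 3 → AnalyticGerm R3) (D2 D3 : Fin 3 → AnalyticGerm hyp) :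
    ∃ D : Fin 3 → VF, D 0 = Pi.single 0 1 ∧ (∀ q, (D 1 q).restrict = D2 q) ∧
      (∀ q, (D 2 q).restrict = D3 q) ∧
      VF.bracket (D 0) (D 1) = ∑ i, (fun q => c12 i * D i q) ∧
      VF.bracket (D 2) (D 0) = ∑ i, (fun q => c31 i * D i q) := by
  -- The equations decouple by component: for each `q`, the pair `(D_2^q, D_3^q)` satisfies its own
  -- linear system, and `D_1^q` contributes the inhomogeneous term.
  choose Y Z hY hZ hY' hZ' using fun q => AnalyticGerm.exists_linear_pair
    (c12 0 * (Pi.single 0 1 : VF) q) (c12 1) (c12 2) (-(c31 0 * (Pi.single 0 1 : VF) q))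
    (-(c31 1)) (-(c31 2)) (D2 q) (D3 q)
  refine ⟨![Pi.single 0 1, Y, Z], rfl, hY, hZ, ?_, ?_⟩
  · funext q
    refine (VF.bracket_single Y q).trans ?_
    rw [hY', Finset.sum_apply, Fin.sum_univ_three]
    rfl
  · funext q
    refine (congrFun (VF.bracket_swap _ _) q).trans ?_
    refine (congrArg Neg.neg (VF.bracket_single Z q)).trans ?_
    rw [hZ', Finset.sum_apply, Fin.sum_univ_three]
    change _ = c31 0 * (Pi.single 0 1 : VF) q + c31 1 * Y q + c31 2 * Z q
    ring

theorem frame_eq {D D' : Fin 3 → VF} {c12 c31 : Fin 3 → AnalyticGerm R3} (h0 : D 0 = Pi.single 0 1)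
    (h0' : D' 0 = Pi.single 0 1) (h1 : ∀ q, (D 1 q).restrict = (D' 1 q).restrict)
    (h2 : ∀ q, (D 2 q).restrict = (D' 2 q).restrict)
    (h12 : VF.bracket (D 0) (D 1) = ∑ i, (fun q => c12 i * D i q))
    (h31 : VF.bracket (D 2) (D 0) = ∑ i, (fun q => c31 i * D i q))
    (h12' : VF.bracket (D' 0) (D' 1) = ∑ i, (fun q => c12 i * D' i q))
    (h31' : VF.bracket (D' 2) (D' 0) = ∑ i, (fun q => c31 i * D' i q)) : D = D' := by
  have key1 : ∀ {D : Fin 3 → VF}, D 0 = Pi.single 0 1 →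
      VF.bracket (D 0) (D 1) = ∑ i, (fun q => c12 i * D i q) → ∀ q, (D 1 q).partialD 0 =
        c12 0 * (Pi.single 0 1 : VF) q + c12 1 * D 1 q + c12 2 * D 2 q := fun h0 h q => by
    have := congrFun h q
    rw [Finset.sum_apply, Fin.sum_univ_three, h0, VF.bracket_single] at this
    exact this
  have key2 : ∀ {D : Fin 3 → VF}, D 0 = Pi.single 0 1 →
      VF.bracket (D 2) (D 0) = ∑ i, (fun q => c31 i * D i q) → ∀ q, (D 2 q).partialD 0 =
        -(c31 0 * (Pi.single 0 1 : VF) q) + -(c31 1) * D 1 q + -(c31 2) * D 2 q :=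
    fun h0 h q => by
      have := congrFun h q
      rw [VF.bracket_swap, Pi.neg_apply, Finset.sum_apply, Fin.sum_univ_three, h0,
        VF.bracket_single] at this
      linear_combination -this
  have h := fun q => AnalyticGerm.eq_of_linear_pair (h1 q) (h2 q) (key1 h0 h12 q) (key2 h0 h31 q)
    (key1 h0' h12' q) (key2 h0' h31' q)
  funext i q
  fin_cases i
  · exact congrFun (h0.trans h0'.symm) q
  · exact (h q).1
  · exact (h q).2

/-! ### Bijectivity -/

/-- The germs `g_i` determined by `a` and `u`. -/
theorem exists_g (a : AnalyticGerm R3) {u : AnalyticGerm R3} (hu : u.val0 ≠ 0) :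
    ∃ g : Fin 3 → AnalyticGerm R3, ∀ i, (g i : Germ (𝓝 (0 : R3)) ℝ) =
      Germ.map₂ (fun a u : ℝ => 1 / 2 * Real.exp a * ![1, -1 - u, -1 - 1 / u] i) a u := by
  obtain ⟨_, a, ha, rfl⟩ := a
  obtain ⟨_, u, hua, rfl⟩ := u
  replace hu : u 0 ≠ 0 := hu
  have h : ∀ i, AnalyticAt ℝ (fun x => ![1, -1 - u x, -1 - 1 / u x] i) 0 := by
    intro i
    fin_cases i
    · exact analyticAt_const
    · exact analyticAt_const.sub hua
    · exact analyticAt_const.sub (analyticAt_const.div hua hu)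
  exact ⟨fun i => ⟨_, _, (analyticAt_const.mul ha.rexp).mul (h i), rfl⟩, fun i => rfl⟩

theorem SolutionGerm.toFreeData_injective : Function.Injective SolutionGerm.toFreeData := by
  intro s t h
  have h31 : s.c 2 0 = t.c 2 0 := congrArg FreeData.c31 h
  have h12 : s.c 0 1 = t.c 0 1 := congrArg FreeData.c12 h
  have hD : s.D = t.D := frame_eq s.D_one t.D_one (congrFun (congrArg FreeData.D2 h))
    (congrFun (congrArg FreeData.D3 h)) (s.structure_eq 0 1) (s.structure_eq 2 0)
    (h12 ▸ t.structure_eq 0 1) (h31 ▸ t.structure_eq 2 0)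
  have hc : s.c = t.c := by
    funext j k
    -- Once the frames coincide, so do the brackets, and linear independence gives equality of all
    -- structure coefficients, including `c_{23}`.
    refine Matrix.vecMul_injective_of_isUnit
      ((Matrix.isUnit_iff_isUnit_det _).mpr (isUnit_det_of_linearIndependent s.frame)) ?_
    have e := s.structure_eq j k
    rw [hD, t.structure_eq j k, sum_mul_eq_vecMul, sum_mul_eq_vecMul] at e
    dsimp only
    rw [hD, e]
  have hu : ∀ s : SolutionGerm, IsUnit s.u := fun s =>
    AnalyticGerm.isUnit_of_val0_ne_zero s.u_pos.ne'
  have hs := (constraint_iff_reducedSystem (hu s) s.g_eq).mp s.constraint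
  have ht := (constraint_iff_reducedSystem (hu t) t.g_eq).mp t.constraint
  rw [← hD, ← hc] at ht
  obtain ⟨ha, hu, hξ⟩ := ReducedSystem.eq_of_restrict s.D_one
    (AnalyticGerm.isUnit_of_val0_ne_zero s.D_two_pos.ne')
    (AnalyticGerm.isUnit_of_val0_ne_zero s.D_three_pos.ne') s.u_pos hs ht
    (congrArg FreeData.a h) (congrArg FreeData.u h) (congrArg FreeData.ξ h)
  refine SolutionGerm.ext hD hc ?_ hξ ha hu
  funext i
  exact Subtype.ext ((s.g_eq i).trans (by rw [ha, hu, t.g_eq i]))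

theorem SolutionGerm.toFreeData_surjective : Function.Surjective SolutionGerm.toFreeData := by
  intro d
  obtain ⟨D, hD0, hD1, hD2, hb12, hb31⟩ := exists_frame d.c12 d.c31 d.D2 d.D3
  have v1 : ∀ q, (D 1 q).val0 = (d.D2 q).val0 := fun q => by
    rw [← hD1, AnalyticGerm.val0_restrict]
  have v2 : ∀ q, (D 2 q).val0 = (d.D3 q).val0 := fun q => by
    rw [← hD2, AnalyticGerm.val0_restrict]
  have hframe : LinearIndependent ℝ (fun i j => (D i j).val0) := by
    convert d.frame using 1
    funext i j
    fin_cases i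
    · change (D 0 j).val0 = (Pi.single 0 1 : R3) j
      rw [hD0]
      by_cases hj : j = 0
      · subst hj
        rw [Pi.single_eq_same, Pi.single_eq_same]
        rfl
      · rw [Pi.single_eq_of_ne hj, Pi.single_eq_of_ne hj]
        rfl
    · exact v1 j
    · exact v2 j
  have hdet := isUnit_det_of_linearIndependent hframe
  obtain ⟨k, hk⟩ : ∃ k : Fin 3 → AnalyticGerm R3,
      VF.bracket (D 1) (D 2) = ∑ i, (fun q => k i * D i q) := by
    -- The coefficients `c_{23}` are not free: they are the components of `[D₂, D₃]` in the frame
    -- already constructed.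
    refine ⟨Matrix.vecMul (VF.bracket (D 1) (D 2)) (Matrix.of D)⁻¹, ?_⟩
    rw [sum_mul_eq_vecMul, Matrix.vecMul_vecMul, Matrix.nonsing_inv_mul _ hdet, Matrix.vecMul_one]
  let c : Fin 3 → Fin 3 → Fin 3 → AnalyticGerm R3 :=
    ![![0, d.c12, -d.c31], ![-d.c12, 0, k], ![d.c31, -k, 0]]
  have hneg : ∀ (k : Fin 3 → AnalyticGerm R3) (X Y : VF),
      VF.bracket X Y = ∑ i, (fun q => k i * D i q) →
      VF.bracket Y X = ∑ i, (fun q => (-k) i * D i q) := fun k X Y h => by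
    rw [VF.bracket_swap, h, sum_mul_eq_vecMul, sum_mul_eq_vecMul, Matrix.neg_vecMul]
  have hself : ∀ X : VF, VF.bracket X X =
      ∑ i, (fun q => (0 : Fin 3 → AnalyticGerm R3) i * D i q) := fun X => by
    rw [VF.bracket_self, sum_mul_eq_vecMul, Matrix.zero_vecMul]
  have hstr : ∀ j k, VF.bracket (D j) (D k) = ∑ i, fun q => c j k i * D i q := by
    intro j k
    fin_cases j <;> fin_cases k
    · exact hself _
    · exact hb12
    · exact hneg _ _ _ hb31
    · exact hneg _ _ _ hb12
    · exact hself _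
    · exact hk
    · exact hb31
    · exact hneg _ _ _ hk
    · exact hself _
  obtain ⟨a, u, ξ, ha, hu, hξ, H⟩ := ReducedSystem.exists_of_restrict (c := c) hD0
    (AnalyticGerm.isUnit_of_val0_ne_zero (by rw [v1]; exact d.D2_pos.ne'))
    (AnalyticGerm.isUnit_of_val0_ne_zero (by rw [v2]; exact d.D3_pos.ne'))
    d.a d.u d.ξ d.u_pos
  have hupos : 0 < u.val0 := by
    rw [← AnalyticGerm.val0_restrict, hu]
    exact d.u_pos
  have huu : IsUnit u := AnalyticGerm.isUnit_of_val0_ne_zero hupos.ne'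
  obtain ⟨g, hg⟩ := exists_g a hupos.ne'
  refine ⟨{ D := D, c := c, g := g, ξ := ξ, a := a, u := u
            frame := hframe
            structure_eq := hstr
            quadratic := ?_
            constraint := (constraint_iff_reducedSystem huu hg).mpr H
            D_one := hD0
            D_two_pos := by rw [v1]; exact d.D2_pos
            D_three_pos := by rw [v2]; exact d.D3_pos
            u_pos := hupos
            g_eq := hg }, ?_⟩
  · obtain ⟨v, huv⟩ := huu.exists_right_inv
    obtain ⟨h0, h1, h2⟩ := two_mul_eq_of_eq_map₂ huv hg
    refine ((isUnit_two.mul isUnit_two).mul_right_eq_zero.mp ?_).symm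
    -- With `v = 1 / u`, four times the quadratic expression is `e^{2a} ((1 + u)(1 + v) - (1 + u) -
    -- (1 + v)) = e^{2a} (u v - 1) = 0`.
    linear_combination (2 * g 2 + 2 * g 0) * h1 + (2 * g 0 - a.exp * (1 + u)) * h2
      - a.exp * (2 + u + v) * h0 + a.exp ^ 2 * huv
  · exact FreeData.ext rfl rfl (funext hD1) (funext hD2) ha hu hξ

end

theorem mainTheorem5 : Function.Bijective SolutionGerm.toFreeData :=
  ⟨SolutionGerm.toFreeData_injective, SolutionGerm.toFreeData_surjective⟩
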